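/- All Hilbert spaces are finite-dimensional and $\log$ is to base 2. For a tripartite quantum state let $I(A;B|E)=S(AE)+S(BE)-S(ABE)-S(E)$, where $S$ is the von Neumann entropy of the respective reduced state. The squashed entanglement of a bipartite state $\rho^{AB}$ is $$E_{sq}(\rho^{AB})=\inf \tfrac12 I(A;B|E),$$ the infimum being over all states $\rho^{ABE}$ with $\mathrm{Tr}_E\,\rho^{ABE}=\rho^{AB}$, where $E$ has arbitrary finite dimension. Let $G$ be a finite abelian group of order $d$, let $\{|i\rangle\}_{i\in G}$ be the standard orthonormal basis of $\mathbb C^G\cong\mathbb C^d$, let $U_0=\mathbb 1$, and let $U_1$ be a Fourier transform of $G$, i.e. $U_1|x\rangle=\frac{1}{\sqrt d}\sum_{y\in G}\chi_x(y)|y\rangle$ for some enumeration $x\mapsto\chi_x$ of the characters of $G$ by the elements of $G$ (for $G=\mathbb Z/d\mathbb Z$ and $\chi_x(y)=e^{2\pi i xy/d}$ this is the discrete Fourier transform of dimension $d$). The flower state is $\rho^{AA'BB'}=\mathrm{Tr}_C|\Psi\rangle\langle\Psi|$, where $$|\Psi\rangle^{AA'BB'C}=\frac1{\sqrt{2d}}\sum_{i\in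 G,\ j\in\{0,1\}}|i\rangle^A|j\rangle^{A'}|i\rangle^B|j\rangle^{B'}\,U_j|i\rangle^C .$$ **Proposition.** With respect to the bipartitions $AA'\,|\,BB'$ and $A\,|\,BB'$ respectively, $$E_{sq}(\rho^{AA'BB'})=1+\tfrac12\log d\qquad\text{and}\qquad E_{sq}(\rho^{ABB'})=0 .$$ Hence squashed entanglement can be locked: for every real $K$ there are a $d\ge1$ and a flower state for $G=\mathbb Z/d\mathbb Z$ with $E_{sq}(\rho^{ABB'})+K\le E_{sq}(\rho^{AA'BB'})$, so that discarding the single qubit $A'$ lowers $E_{sq}$ by an arbitrarily large amount. Moreover, $E_{sq}$ does not have the property Non Lock: there is no constant $c\ge 0$ such that $E_{sq}(\rho^{AA'B})\le E_{sq}(\rho^{AB})+c\log\operatorname{Rank}\rho^{A'}$ for all states $\rho^{AA'B}$, where $\rho^{AA'B}$ is regarded as bipartite between $AA'$ and $B$, and $\rho^{AB}$ between $A$ and $B$. -/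

import Mathlib

open scoped ComplexOrder

noncomputable section

/-- A quantum state on the finite-dimensional Hilbert space `ℂ^ι`: a positive operator of trace
one, given by its matrix in the standard basis. A composite system `X ⊗ Y` with
`X = ℂ^ι`, `Y = ℂ^κ` is the space `ℂ^(ι × κ)`. -/
@[ext]
structure QState (ι : Type*) [Fintype ι] where
  mat : Matrix ι ι ℂ
  posSemidef : mat.PosSemidef
  trace_eq_one : mat.trace = 1

namespace QState

/-- The reduced state on the first factor of a decomposition `e` of the index set:
the partial trace over the second factor. -/
def marginal {ι κ μ : Type*} [Fintype ι] [Fintype κ] [Fintype μ] (e : ι ≃ κ × μ)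
    (ρ : QState ι) : QState κ where
  mat := ∑ m, ρ.mat.submatrix (fun k => e.symm (k, m)) (fun k => e.symm (k, m))
  posSemidef := Matrix.posSemidef_sum _ fun m _ => ρ.posSemidef.submatrix _
  trace_eq_one := by
    rw [← ρ.trace_eq_one, Matrix.trace_sum, Matrix.trace]
    simp only [Matrix.trace, Matrix.diag, Matrix.submatrix_apply]
    rw [Finset.sum_comm, ← Fintype.sum_prod_type' (f := fun k m =>
      ρ.mat (e.symm (k, m)) (e.symm (k, m)))]
    exact e.symm.sum_comp (fun i => ρ.mat i i)

/-- `ρ^X = Tr_Y ρ^{XY}`. -/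
def fst {X Y : Type*} [Fintype X] [Fintype Y] (ρ : QState (X × Y)) : QState X :=
  ρ.marginal (Equiv.refl _)

/-- `ρ^Y = Tr_X ρ^{XY}`. -/
def snd {X Y : Type*} [Fintype X] [Fintype Y] (ρ : QState (X × Y)) : QState Y :=
  ρ.marginal (Equiv.prodComm X Y)

/-- The reduced state on the first and third of three systems: `ρ^{XZ} = Tr_Y ρ^{XYZ}`. -/
def fstThd {X Y Z : Type*} [Fintype X] [Fintype Y] [Fintype Z]
    (ρ : QState ((X × Y) × Z)) : QState (X × Z) :=
  ρ.marginal
    { toFun := fun p => ((p.1.1, p.2), p.1.2)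
      invFun := fun q => ((q.1.1, q.2), q.1.2)
      left_inv := fun _ => rfl
      right_inv := fun _ => rfl }

/-- The reduced state on the second and third of three systems: `ρ^{YZ} = Tr_X ρ^{XYZ}`. -/
def sndThd {X Y Z : Type*} [Fintype X] [Fintype Y] [Fintype Z]
    (ρ : QState ((X × Y) × Z)) : QState (Y × Z) :=
  ρ.marginal
    { toFun := fun p => ((p.1.2, p.2), p.1.1)
      invFun := fun q => ((q.2, q.1.1), q.1.2)
      left_inv := fun _ => rfl
      right_inv := fun _ => rfl }

/-- The von Neumann entropy `S(ρ) = -Tr ρ log ρ = -∑ λ log λ`, the sum being over the eigenvalues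
of `ρ` with multiplicity, with logarithms to base two and `0 log 0 = 0`. -/
def entropy {ι : Type*} [Fintype ι] [DecidableEq ι] (ρ : QState ι) : ℝ :=
  -∑ i, ρ.posSemidef.isHermitian.eigenvalues i *
    Real.logb 2 (ρ.posSemidef.isHermitian.eigenvalues i)

/-- The quantum conditional mutual information
`I(A;B|E) = S(AE) + S(BE) - S(ABE) - S(E)` of a tripartite state `ρ^{ABE}`. -/
def condMutualInfo {A B E : Type*} [Fintype A] [DecidableEq A] [Fintype B] [DecidableEq B]
    [Fintype E] [DecidableEq E] (ρ : QState ((A × B) × E)) : ℝ :=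
  ρ.fstThd.entropy + ρ.sndThd.entropy - ρ.entropy - ρ.snd.entropy

/-- The squashed entanglement of a bipartite state `ρ^{AB}`: the infimum of `I(A;B|E)/2` over all
extensions `ρ^{ABE}` of `ρ^{AB}`, with `E` of arbitrary finite dimension `n`. The infimum is taken
in the extended reals, where it is always a genuine greatest lower bound. -/
def squashedEntanglement {A B : Type*} [Fintype A] [DecidableEq A] [Fintype B] [DecidableEq B]
    (ρ : QState (A × B)) : EReal :=
  ⨅ (n : ℕ) (σ : QState ((A × B) × Fin n)) (_ : σ.fst = ρ),
    ((1 / 2 * σ.condMutualInfo : ℝ) : EReal)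

/-- The property `Non Lock` of a function `E` on bipartite states: there is `c ≥ 0` such that
`E(ρ^{AA'B}) ≤ E(ρ^{AB}) + c log Rank ρ^{A'}` for all states `ρ^{AA'B}`, regarded as bipartite
between `AA'` and `B`. -/
def NonLock (E : ∀ (A B : Type) [Fintype A] [DecidableEq A] [Fintype B] [DecidableEq B],
    QState (A × B) → EReal) : Prop :=
  ∃ c : ℝ, 0 ≤ c ∧
    ∀ (A A' B : Type) [Fintype A] [DecidableEq A] [Fintype A'] [DecidableEq A']
      [Fintype B] [DecidableEq B] (ρ : QState ((A × A') × B)),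
      E (A × A') B ρ ≤ E A B ρ.fstThd + ((c * Real.logb 2 ρ.fst.snd.mat.rank : ℝ) : EReal)

/-- The pure state `|ψ⟩⟨ψ|` of a unit vector `ψ`. -/
def pure {ι : Type*} [Fintype ι] (ψ : ι → ℂ) (hψ : ∑ i, ‖ψ i‖ ^ 2 = 1) : QState ι where
  mat := Matrix.vecMulVec ψ (star ψ)
  posSemidef := Matrix.posSemidef_vecMulVec_self_star ψ
  trace_eq_one := by
    simp only [Matrix.trace, Matrix.diag, Matrix.vecMulVec_apply, Pi.star_apply]
    have h : ∀ i, ψ i * star (ψ i) = ((‖ψ i‖ ^ 2 : ℝ) : ℂ) := fun i => by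
      simpa using Complex.mul_conj' (ψ i)
    rw [Finset.sum_congr rfl fun i _ => h i, ← Complex.ofReal_sum, hψ, Complex.ofReal_one]

end QState

/-- `U_0 = 1` and `U_1 = U`. -/
def flowerUnitary {ι : Type*} [Fintype ι] [DecidableEq ι] (U : Matrix.unitaryGroup ι ℂ)
    (j : Fin 2) : Matrix.unitaryGroup ι ℂ :=
  if j = 0 then 1 else U

/-- The vector `(2d)^{-1/2} ∑_{i,j} |i⟩^A |j⟩^{A'} |i⟩^B |j⟩^{B'} U_j|i⟩^C`, where `i` ranges over
the index set `ι` of size `d` and `j` over `{0, 1}`, given by its coordinates. Its systems are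
arranged as `((A A') (B B')) C`. -/
def flowerKet {ι : Type*} [Fintype ι] [DecidableEq ι] (U : Matrix.unitaryGroup ι ℂ) :
    ((ι × Fin 2) × (ι × Fin 2)) × ι → ℂ :=
  fun p => ((Real.sqrt (2 * Fintype.card ι) : ℝ) : ℂ)⁻¹ *
    ∑ i : ι, ∑ j : Fin 2,
      if p.1 = ((i, j), (i, j)) then (flowerUnitary U j : Matrix ι ι ℂ) p.2 i else 0

theorem flowerKet_norm {ι : Type*} [Fintype ι] [DecidableEq ι] [Nonempty ι]
    (U : Matrix.unitaryGroup ι ℂ) : ∑ p, ‖flowerKet U p‖ ^ 2 = 1 := by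
  have hcol : ∀ (V : Matrix.unitaryGroup ι ℂ) (i : ι),
      ∑ c, ‖(V : Matrix ι ι ℂ) c i‖ ^ 2 = 1 := by
    intro V i
    have h := congrFun (congrFun (Matrix.UnitaryGroup.star_mul_self V) i) i
    simp only [Matrix.mul_apply, Matrix.star_apply, Matrix.one_apply_eq] at h
    have h2 : ∀ c, star ((V : Matrix ι ι ℂ) c i) * (V : Matrix ι ι ℂ) c i
        = ((‖(V : Matrix ι ι ℂ) c i‖ ^ 2 : ℝ) : ℂ) := fun c => by
      simpa using Complex.conj_mul' ((V : Matrix ι ι ℂ) c i)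
    rw [Finset.sum_congr rfl fun c _ => h2 c, ← Complex.ofReal_sum] at h
    exact_mod_cast h
  have hval : ∀ (q r : ι × Fin 2) (c : ι), flowerKet U ((q, r), c) =
      ((Real.sqrt (2 * Fintype.card ι) : ℝ) : ℂ)⁻¹ *
        if r = q then (flowerUnitary U q.2 : Matrix ι ι ℂ) c q.1 else 0 := by
    intro q r c
    unfold flowerKet
    congr 1
    rw [← Fintype.sum_prod_type' (f := fun i j => if ((q, r), c).1 = ((i, j), (i, j)) then
      (flowerUnitary U j : Matrix ι ι ℂ) c i else 0)]
    rw [Finset.sum_eq_single q]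
    · simp
    · intro b _ hb
      rw [if_neg]
      intro h
      exact hb (Prod.ext_iff.mp h).1.symm
    · simp
  have hd : (0 : ℝ) < 2 * Fintype.card ι := by
    have := Fintype.card_pos (α := ι)
    positivity
  have hn : ∀ (q r : ι × Fin 2) (c : ι), ‖flowerKet U ((q, r), c)‖ ^ 2 =
      if r = q then (2 * Fintype.card ι : ℝ)⁻¹ *
        ‖(flowerUnitary U q.2 : Matrix ι ι ℂ) c q.1‖ ^ 2 else 0 := by
    intro q r c
    rw [hval]
    split_ifs with h
    · rw [norm_mul, norm_inv, Complex.norm_real, Real.norm_eq_abs, mul_pow, inv_pow, sq_abs,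
        Real.sq_sqrt hd.le]
    · simp
  rw [Fintype.sum_prod_type, Fintype.sum_prod_type]
  simp only [hn]
  have hs : ∀ q : ι × Fin 2, (∑ r : ι × Fin 2, ∑ c : ι,
      if r = q then (2 * Fintype.card ι : ℝ)⁻¹ *
        ‖(flowerUnitary U q.2 : Matrix ι ι ℂ) c q.1‖ ^ 2 else 0) =
      (2 * Fintype.card ι : ℝ)⁻¹ := by
    intro q
    rw [Finset.sum_eq_single q]
    · simp only [if_true, ← Finset.mul_sum, hcol, mul_one]
    · intro r _ hr
      simp [hr]
    · simp
  simp only [hs, Finset.sum_const, Finset.card_univ, Fintype.card_prod, Fintype.card_fin,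
    nsmul_eq_mul]
  push_cast
  field_simp

/-- The flower state `ρ^{AA'BB'} = Tr_C |Ψ⟩⟨Ψ|`. -/
def flowerState {ι : Type*} [Fintype ι] [DecidableEq ι] [Nonempty ι]
    (U : Matrix.unitaryGroup ι ℂ) : QState ((ι × Fin 2) × (ι × Fin 2)) :=
  (QState.pure (flowerKet U) (flowerKet_norm U)).fst

/-- `U` is a Fourier transform of the finite abelian group `G` of order `d`:
`U|x⟩ = d^{-1/2} ∑_y χ_x(y)|y⟩` for an enumeration `x ↦ χ_x` of the characters of `G` by the
elements of `G`. For `G = ℤ/dℤ` and `χ_x(y) = exp(2πixy/d)` this is the discrete Fourier transform,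
and for `G = (ℤ/2ℤ)^l` and `χ_x(y) = (-1)^(x·y)` it is the `l`-fold tensor power of the
Hadamard transform. -/
def IsFourierTransform {G : Type*} [AddCommGroup G] [Fintype G] [DecidableEq G]
    (U : Matrix.unitaryGroup G ℂ) : Prop :=
  ∃ χ : G ≃ AddChar G ℂ, ∀ x y : G,
    (U : Matrix G G ℂ) y x = ((Real.sqrt (Fintype.card G) : ℝ) : ℂ)⁻¹ * χ x y

end

/-! The flower state is `d⁻¹ V Vᴴ` for an isometry `V` from the purifying system `C` into `AA'BB'`,
so every extension by `E` has the form `(V ⊗ 1) ω (V ⊗ 1)ᴴ` for a state `ω` of `E` and `C`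
(`eq_conj_flowerCompression`). Both `S(AA'E)` and `S(BB'E)` are then the entropy of `E` with the
record of a measurement of `C` in one of two bases, chosen by a fair bit. In nats this gives `I = 2
log 2 + S(XE) + S(ZE) - S(CE) - S(E)`, where `X`, `Z` are the outcomes in the two bases. These are
mutually unbiased because characters have modulus one, and the uncertainty relation with quantum
side information, `S(XE) + S(ZE) ≥ S(CE) + S(E) + log d` (`vonNeumann_uncertainty`), gives the lower
bound. A trivial `E` attains it.

Once `A'` is discarded the state is classical with `A` a function of `B`; a copy of `A` in `E` makes
the conditional mutual information vanish. Nonnegativity of `squashedEntanglement` is strong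
subadditivity.

The uncertainty relation and strong subadditivity both follow from monotonicity of relative entropy
(`relEnt_blockDiagonal_krausMap_le`), with different channels and reference operators. Monotonicity
is proved through an integral representation: for each `t ≥ 0` the integrand is the maximum over `X`
of the quadratic form `relEntForm t ρ σ X`, which the Kadison-Schwarz inequality compares before and
after the channel. -/

noncomputable section

set_option linter.unusedSectionVars false

namespace Matrix

open Finset

/-! ### Completely positive maps and the Kadison-Schwarz inequality. -/

section Kraus

variable {m n κ : Type*} [Fintype m] [Fintype κ]

/-- The completely positive map `M ↦ ∑ k, V k * M * (V k)ᴴ` with Kraus operators `V k`. -/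
def krausMap [Fintype n] (V : κ → Matrix m n ℂ) (M : Matrix n n ℂ) : Matrix m m ℂ :=
  ∑ k, V k * M * (V k)ᴴ

/-- The dual `Y ↦ ∑ k, (V k)ᴴ * Y * V k` of `krausMap V`. -/
def krausDual (V : κ → Matrix m n ℂ) (Y : Matrix m m ℂ) : Matrix n n ℂ :=
  ∑ k, (V k)ᴴ * Y * V k

theorem krausDual_conjTranspose (V : κ → Matrix m n ℂ) (Y : Matrix m m ℂ) :
    (krausDual V Y)ᴴ = krausDual V Yᴴ := by
  simp [krausDual, conjTranspose_sum, conjTranspose_mul, Matrix.mul_assoc]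

variable [Fintype n]

theorem trace_mul_krausMap (V : κ → Matrix m n ℂ) (Y : Matrix m m ℂ) (M : Matrix n n ℂ) :
    trace (Y * krausMap V M) = trace (krausDual V Y * M) := by
  simp only [krausMap, krausDual, Matrix.mul_sum, Matrix.sum_mul, trace_sum]
  refine sum_congr rfl fun k _ => ?_
  rw [← Matrix.mul_assoc, trace_mul_comm]
  simp only [Matrix.mul_assoc]

theorem trace_krausMap [DecidableEq m] [DecidableEq n] {V : κ → Matrix m n ℂ}
    (hV : ∑ k, (V k)ᴴ * V k = 1) (M : Matrix n n ℂ) : trace (krausMap V M) = trace M := by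
  simpa [krausDual, hV] using trace_mul_krausMap V 1 M

theorem PosSemidef.krausMap (V : κ → Matrix m n ℂ) {M : Matrix n n ℂ} (hM : M.PosSemidef) :
    (krausMap V M).PosSemidef :=
  posSemidef_sum _ fun k _ => hM.mul_mul_conjTranspose_same (V k)

theorem PosSemidef.re_trace_nonneg {M : Matrix n n ℂ} (hM : M.PosSemidef) :
    0 ≤ (trace M).re :=
  (Complex.nonneg_iff.mp hM.trace_nonneg).1

/-- The Kadison-Schwarz inequality for a unital completely positive map, tested against a
positive semidefinite matrix. -/
theorem re_trace_krausDual_mul_krausDual_le [DecidableEq n] {V : κ → Matrix m n ℂ}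
    (hV : ∑ k, (V k)ᴴ * V k = 1) (Y : Matrix m m ℂ) {M : Matrix n n ℂ} (hM : M.PosSemidef) :
    (trace ((krausDual V Y)ᴴ * krausDual V Y * M)).re ≤
      (trace (krausDual V (Yᴴ * Y) * M)).re := by
  set X := krausDual V Y with hX
  -- The defect is a sum of squares of the commutator-like terms `Y V k - V k X`; the three other
  -- products collapse to `Xᴴ X` by the definition of `X` and by `hV`.
  have key : krausDual V (Yᴴ * Y) - Xᴴ * X =
      ∑ k, (Y * V k - V k * X)ᴴ * (Y * V k - V k * X) := by
    have h1 : ∑ k, (V k)ᴴ * Yᴴ * (V k * X) = Xᴴ * X := by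
      conv_rhs => rw [hX, krausDual_conjTranspose, ← hX, krausDual, Matrix.sum_mul]
      simp only [Matrix.mul_assoc]
    have h2 : ∑ k, (Xᴴ * (V k)ᴴ) * (Y * V k) = Xᴴ * X := by
      conv_rhs => rw [show Xᴴ * X = Xᴴ * krausDual V Y from rfl, krausDual, Matrix.mul_sum]
      simp only [Matrix.mul_assoc]
    have h3 : ∑ k, (Xᴴ * (V k)ᴴ) * (V k * X) = Xᴴ * X := by
      calc ∑ k, (Xᴴ * (V k)ᴴ) * (V k * X) = Xᴴ * (∑ k, (V k)ᴴ * V k) * X := by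
            simp only [Matrix.mul_sum, Matrix.sum_mul, Matrix.mul_assoc]
        _ = Xᴴ * X := by rw [hV, Matrix.mul_one]
    simp only [conjTranspose_sub, conjTranspose_mul, Matrix.sub_mul, Matrix.mul_sub,
      sum_sub_distrib, h1, h2, h3, krausDual]
    simp only [Matrix.mul_assoc]
    abel
  have h : 0 ≤ (trace ((krausDual V (Yᴴ * Y) - Xᴴ * X) * M)).re := by
    rw [key, Matrix.sum_mul, trace_sum, Complex.re_sum]
    refine sum_nonneg fun k _ => ?_
    rw [Matrix.mul_assoc, trace_mul_comm]
    exact (hM.mul_mul_conjTranspose_same _).re_trace_nonneg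
  rw [Matrix.sub_mul, trace_sub, Complex.sub_re] at h
  linarith

/-- The concave quadratic function of `X` whose maximum is the integrand of the
integral representation of the relative entropy of `ρ` and `σ`. -/
def relEntForm (t : ℝ) (ρ σ X : Matrix n n ℂ) : ℝ :=
  2 * (trace (Xᴴ * ρ)).re - (trace (Xᴴ * X * σ)).re - t * (trace (X * Xᴴ * ρ)).re

/-- The linear term passes to the dual map exactly. Kadison-Schwarz is applied to `Y` against `σ`
and to `Yᴴ` against `ρ`; both quadratic terms enter with a minus sign, since `t ≥ 0`. -/
theorem relEntForm_krausMap_le [DecidableEq n] {V : κ → Matrix m n ℂ}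
    (hV : ∑ k, (V k)ᴴ * V k = 1) {t : ℝ} (ht : 0 ≤ t) {ρ σ : Matrix n n ℂ}
    (hρ : ρ.PosSemidef) (hσ : σ.PosSemidef) (Y : Matrix m m ℂ) :
    relEntForm t (krausMap V ρ) (krausMap V σ) Y ≤ relEntForm t ρ σ (krausDual V Y) := by
  have h1 := re_trace_krausDual_mul_krausDual_le hV Y hσ
  have h2 := re_trace_krausDual_mul_krausDual_le hV Yᴴ hρ
  rw [krausDual_conjTranspose, conjTranspose_conjTranspose] at h2
  have h3 := mul_le_mul_of_nonneg_left h2 ht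
  unfold relEntForm
  rw [trace_mul_krausMap, trace_mul_krausMap, trace_mul_krausMap, krausDual_conjTranspose]
  rw [krausDual_conjTranspose] at h1
  linarith

end Kraus

/-! ### The integral representation of relative entropy in eigenbases. -/

section Spectral

variable {n : Type*} [Fintype n] [DecidableEq n]

/-- The Hermitian matrix with eigenbasis `U` and eigenvalues `p`. -/
def spectralMatrix (U : unitaryGroup n ℂ) (p : n → ℝ) : Matrix n n ℂ :=
  (U : Matrix n n ℂ) * diagonal (fun i => (p i : ℂ)) * (U : Matrix n n ℂ)ᴴ

theorem IsHermitian.eq_spectralMatrix {A : Matrix n n ℂ} (hA : A.IsHermitian) :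
    A = spectralMatrix hA.eigenvectorUnitary hA.eigenvalues := by
  conv_lhs => rw [hA.spectral_theorem]
  rfl

/-- The overlaps `|⟨u i, w j⟩|²` of two eigenbases. -/
def overlap (U W : unitaryGroup n ℂ) (i j : n) : ℝ :=
  Complex.normSq (((U : Matrix n n ℂ)ᴴ * (W : Matrix n n ℂ)) i j)

theorem trace_mul_diagonal_mul (x y : Matrix n n ℂ) (p : n → ℝ) :
    trace (x * diagonal (fun i => (p i : ℂ)) * y) = ∑ i, ∑ j, p j * (x i j * y j i) := by
  simp only [trace, diag, mul_apply (M := _ * _), mul_diagonal]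
  refine sum_congr rfl fun i _ => sum_congr rfl fun j _ => by ring

theorem trace_spectralMatrix_mul_spectralMatrix (U W : unitaryGroup n ℂ) (p q : n → ℝ) :
    (trace (spectralMatrix U p * spectralMatrix W q)).re =
      ∑ i, ∑ j, overlap U W i j * (p i * q j) := by
  have : trace (spectralMatrix U p * spectralMatrix W q) =
      trace (((U : Matrix n n ℂ)ᴴ * (W : Matrix n n ℂ)) * diagonal (fun i => (q i : ℂ)) *
        (((U : Matrix n n ℂ)ᴴ * (W : Matrix n n ℂ))ᴴ * diagonal (fun i => (p i : ℂ)))) := by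
    unfold spectralMatrix
    rw [trace_mul_comm, conjTranspose_mul, conjTranspose_conjTranspose]
    rw [← Matrix.mul_assoc, trace_mul_comm, ← Matrix.mul_assoc]
    simp only [Matrix.mul_assoc]
  rw [this, trace_mul_diagonal_mul, Complex.re_sum]
  refine sum_congr rfl fun i _ => ?_
  rw [Complex.re_sum]
  refine sum_congr rfl fun j _ => ?_
  rw [mul_diagonal, conjTranspose_apply, ← mul_assoc (_ : ℂ) (star _) _, Complex.star_def,
    Complex.mul_conj, overlap]
  norm_cast
  ring

theorem unitary_conjTranspose_mul_self (U : unitaryGroup n ℂ) :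
    (U : Matrix n n ℂ)ᴴ * (U : Matrix n n ℂ) = 1 :=
  UnitaryGroup.star_mul_self U

theorem unitary_mul_conjTranspose_self (U : unitaryGroup n ℂ) :
    (U : Matrix n n ℂ) * (U : Matrix n n ℂ)ᴴ = 1 :=
  mem_unitaryGroup_iff.mp U.2

theorem sum_overlap_right (U W : unitaryGroup n ℂ) (i : n) : ∑ j, overlap U W i j = 1 := by
  have h : (((U : Matrix n n ℂ)ᴴ * (W : Matrix n n ℂ)) *
      ((U : Matrix n n ℂ)ᴴ * (W : Matrix n n ℂ))ᴴ) i i = 1 := by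
    rw [conjTranspose_mul, conjTranspose_conjTranspose, Matrix.mul_assoc,
      ← Matrix.mul_assoc (W : Matrix n n ℂ), unitary_mul_conjTranspose_self, Matrix.one_mul,
      unitary_conjTranspose_mul_self, one_apply_eq]
  rw [mul_apply] at h
  simp only [conjTranspose_apply, Complex.star_def, Complex.mul_conj] at h
  exact_mod_cast h

/-- In coordinates adapted to the two eigenbases the form decouples into one scalar quadratic per
matrix entry, so it can be maximised entry by entry. -/
theorem relEntForm_spectralMatrix (t : ℝ) (U W : unitaryGroup n ℂ) (p q : n → ℝ)
    (x : Matrix n n ℂ) :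
    relEntForm t (spectralMatrix U p) (spectralMatrix W q)
      ((U : Matrix n n ℂ) * x * (W : Matrix n n ℂ)ᴴ) =
      ∑ i, ∑ j, (2 * (star (x i j) * (p i * ((U : Matrix n n ℂ)ᴴ * (W : Matrix n n ℂ)) i j)).re -
        Complex.normSq (x i j) * (q j + t * p i)) := by
  have hU := unitary_conjTranspose_mul_self U
  have hW := unitary_conjTranspose_mul_self W
  set u : Matrix n n ℂ := (U : Matrix n n ℂ)
  set w : Matrix n n ℂ := (W : Matrix n n ℂ)
  have e1 : trace ((u * x * wᴴ)ᴴ * spectralMatrix U p) =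
      ∑ i, ∑ j, star (x i j) * (p i * (uᴴ * w) i j) := by
    have : trace ((u * x * wᴴ)ᴴ * spectralMatrix U p) =
        trace (xᴴ * diagonal (fun i => (p i : ℂ)) * (uᴴ * w)) := by
      calc _ = trace (w * (xᴴ * (uᴴ * u) * diagonal (fun i => (p i : ℂ)) * uᴴ)) := by
            simp [spectralMatrix, conjTranspose_mul, Matrix.mul_assoc, u]
        _ = _ := by rw [trace_mul_comm, hU]; simp only [Matrix.mul_assoc, Matrix.mul_one]
    rw [this, trace_mul_diagonal_mul, sum_comm]
    refine sum_congr rfl fun i _ => sum_congr rfl fun j _ => ?_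
    rw [conjTranspose_apply]; ring
  have e2 : trace ((u * x * wᴴ)ᴴ * (u * x * wᴴ) * spectralMatrix W q) =
      ∑ i, ∑ j, (Complex.normSq (x i j) * q j : ℝ) := by
    have : trace ((u * x * wᴴ)ᴴ * (u * x * wᴴ) * spectralMatrix W q) =
        trace (x * diagonal (fun i => (q i : ℂ)) * xᴴ) := by
      calc _ = trace (w * (xᴴ * (uᴴ * u) * x * (wᴴ * w) * diagonal (fun i => (q i : ℂ)) * wᴴ)) := by
            simp [spectralMatrix, conjTranspose_mul, Matrix.mul_assoc, w]
        _ = trace (xᴴ * (x * diagonal (fun i => (q i : ℂ)) * (wᴴ * w))) := by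
            rw [trace_mul_comm, hU, hW]
            simp only [Matrix.mul_assoc, Matrix.mul_one, hW]
        _ = _ := by rw [trace_mul_comm, hW, Matrix.mul_one]
    rw [this, trace_mul_diagonal_mul]
    push_cast
    refine sum_congr rfl fun i _ => sum_congr rfl fun j _ => ?_
    rw [conjTranspose_apply, Complex.star_def, Complex.mul_conj]; ring
  have e3 : trace ((u * x * wᴴ) * (u * x * wᴴ)ᴴ * spectralMatrix U p) =
      ∑ i, ∑ j, (Complex.normSq (x i j) * p i : ℝ) := by
    have : trace ((u * x * wᴴ) * (u * x * wᴴ)ᴴ * spectralMatrix U p) =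
        trace (xᴴ * diagonal (fun i => (p i : ℂ)) * x) := by
      calc _ = trace (u * (x * (wᴴ * w) * xᴴ * (uᴴ * u) * diagonal (fun i => (p i : ℂ)) * uᴴ)) := by
            simp [spectralMatrix, conjTranspose_mul, Matrix.mul_assoc, u]
        _ = trace (x * (xᴴ * diagonal (fun i => (p i : ℂ)) * (uᴴ * u))) := by
            rw [trace_mul_comm, hU, hW]
            simp only [Matrix.mul_assoc, Matrix.mul_one, hU]
        _ = _ := by rw [trace_mul_comm, hU, Matrix.mul_one]
    rw [this, trace_mul_diagonal_mul, sum_comm]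
    push_cast
    refine sum_congr rfl fun i _ => sum_congr rfl fun j _ => ?_
    rw [conjTranspose_apply, mul_comm (star _), Complex.star_def, Complex.mul_conj]; ring
  unfold relEntForm
  rw [e1, e2, e3]
  simp only [Complex.re_sum, Complex.ofReal_re, mul_sum, ← sum_sub_distrib]
  refine sum_congr rfl fun i _ => sum_congr rfl fun j _ => ?_
  ring

/-- The maximum over `X` of `relEntForm t ρ σ X`. -/
def relEntIntegrand (t : ℝ) (U W : unitaryGroup n ℂ) (p q : n → ℝ) : ℝ :=
  ∑ i, ∑ j, overlap U W i j * (p i * (p i / (q j + t * p i)))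

theorem relEntForm_le_relEntIntegrand {t : ℝ} (ht : 0 ≤ t) (U W : unitaryGroup n ℂ) {p q : n → ℝ}
    (hp : ∀ i, 0 ≤ p i) (hq : ∀ i, 0 < q i) (X : Matrix n n ℂ) :
    relEntForm t (spectralMatrix U p) (spectralMatrix W q) X ≤ relEntIntegrand t U W p q := by
  have hX : X = (U : Matrix n n ℂ) * ((U : Matrix n n ℂ)ᴴ * X * (W : Matrix n n ℂ)) *
      (W : Matrix n n ℂ)ᴴ := by
    simp only [Matrix.mul_assoc, unitary_mul_conjTranspose_self, Matrix.mul_one]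
    rw [← Matrix.mul_assoc, unitary_mul_conjTranspose_self, Matrix.one_mul]
  rw [hX, relEntForm_spectralMatrix]
  refine sum_le_sum fun i _ => sum_le_sum fun j _ => ?_
  generalize ((U : Matrix n n ℂ)ᴴ * X * (W : Matrix n n ℂ)) i j = x
  have hc : 0 < q j + t * p i := by nlinarith [hp i, hq j, mul_nonneg ht (hp i)]
  rw [overlap]
  generalize ((U : Matrix n n ℂ)ᴴ * (W : Matrix n n ℂ)) i j = v
  have h0 : 0 ≤ Complex.normSq ((q j + t * p i : ℝ) * x - p i * v) := Complex.normSq_nonneg _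
  -- Completing the square in the single entry `x`.
  have h1 : Complex.normSq ((q j + t * p i : ℝ) * x - p i * v) =
      (q j + t * p i) * (Complex.normSq v * (p i * p i) / (q j + t * p i) -
        (2 * (star x * (p i * v)).re - Complex.normSq x * (q j + t * p i))) := by
    field_simp
    simp [Complex.normSq_apply]
    ring
  rw [h1] at h0
  have h2 := nonneg_of_mul_nonneg_right h0 hc
  have h3 : Complex.normSq v * (p i * (p i / (q j + t * p i))) =
    Complex.normSq v * (p i * p i) / (q j + t * p i) := by ring
  rw [h3]
  linarith

theorem exists_relEntForm_eq_relEntIntegrand {t : ℝ} (ht : 0 ≤ t) (U W : unitaryGroup n ℂ)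
    {p q : n → ℝ} (hp : ∀ i, 0 ≤ p i) (hq : ∀ i, 0 < q i) :
    ∃ X, relEntForm t (spectralMatrix U p) (spectralMatrix W q) X = relEntIntegrand t U W p q := by
  -- The maximiser is the zero of the completed square in each entry.
  refine ⟨(U : Matrix n n ℂ) * (Matrix.of fun i j => ((p i / (q j + t * p i) : ℝ) : ℂ) *
    ((U : Matrix n n ℂ)ᴴ * (W : Matrix n n ℂ)) i j) * (W : Matrix n n ℂ)ᴴ, ?_⟩
  rw [relEntForm_spectralMatrix]
  refine sum_congr rfl fun i _ => sum_congr rfl fun j _ => ?_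
  have hc : 0 < q j + t * p i := by nlinarith [hp i, hq j, mul_nonneg ht (hp i)]
  rw [overlap, of_apply]
  generalize ((U : Matrix n n ℂ)ᴴ * (W : Matrix n n ℂ)) i j = v
  have hcc : p i / (q j + t * p i) * (q j + t * p i) = p i := div_mul_cancel₀ _ hc.ne'
  generalize p i / (q j + t * p i) = r at *
  generalize q j + t * p i = c at *
  rw [← hcc]
  simp only [Complex.normSq_apply, Complex.star_def, map_mul, Complex.conj_ofReal, Complex.mul_re,
    Complex.mul_im, Complex.ofReal_re, Complex.ofReal_im, Complex.conj_re, Complex.conj_im]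
  ring

/-- The relative entropy `Tr ρ (log ρ - log σ)` in terms of the spectral data of `ρ` and `σ`. -/
def spectralRelEnt (U W : unitaryGroup n ℂ) (p q : n → ℝ) : ℝ :=
  ∑ i, ∑ j, overlap U W i j * (p i * (Real.log (p i) - Real.log (q j)))

/-- The integral of `relEntIntegrand` from `0` to `T`. -/
def relEntTruncated (U W : unitaryGroup n ℂ) (p q : n → ℝ) (T : ℝ) : ℝ :=
  ∑ i, ∑ j, overlap U W i j * (p i * (Real.log (q j + T * p i) - Real.log (q j)))

theorem hasDerivAt_relEntTruncated {t : ℝ} (ht : 0 ≤ t) (U W : unitaryGroup n ℂ)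
    {p q : n → ℝ} (hp : ∀ i, 0 ≤ p i) (hq : ∀ i, 0 < q i) :
    HasDerivAt (relEntTruncated U W p q) (relEntIntegrand t U W p q) t := by
  unfold relEntTruncated relEntIntegrand
  refine HasDerivAt.fun_sum fun i _ => HasDerivAt.fun_sum fun j _ => ?_
  refine HasDerivAt.const_mul _ (HasDerivAt.const_mul _ (HasDerivAt.sub_const _ ?_))
  have hc : 0 < q j + t * p i := by nlinarith [hp i, hq j, mul_nonneg ht (hp i)]
  refine HasDerivAt.log ?_ hc.ne'
  simpa using ((hasDerivAt_id t).mul_const (p i)).const_add (q j)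

/-- The truncated integral diverges like `log T` times the trace, so this is subtracted before `T →
∞`. Indices with `p i = 0` contribute nothing, and for the others `q j / T + p i → p i`. -/
theorem tendsto_relEntTruncated (U W : unitaryGroup n ℂ)
    {p q : n → ℝ} (hp : ∀ i, 0 ≤ p i) (hq : ∀ i, 0 < q i) :
    Filter.Tendsto (fun T => relEntTruncated U W p q T - Real.log T * ∑ i, p i) Filter.atTop
      (nhds (spectralRelEnt U W p q)) := by
  have h1 : ∀ᶠ T : ℝ in Filter.atTop, ∑ i, ∑ j, overlap U W i j *
      (p i * (Real.log (q j / T + p i) - Real.log (q j))) =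
      relEntTruncated U W p q T - Real.log T * ∑ i, p i := by
    filter_upwards [Filter.eventually_gt_atTop 0] with T hT
    have h2 : ∑ i, p i = ∑ i, ∑ j, overlap U W i j * p i := by
      refine sum_congr rfl fun i _ => ?_
      rw [← sum_mul, sum_overlap_right, one_mul]
    rw [h2, relEntTruncated, mul_sum, ← sum_sub_distrib]
    refine sum_congr rfl fun i _ => ?_
    rw [mul_sum, ← sum_sub_distrib]
    refine sum_congr rfl fun j _ => ?_
    have hc : 0 < q j + T * p i := by nlinarith [hp i, hq j, mul_nonneg hT.le (hp i)]
    have h3 : q j / T + p i = (q j + T * p i) / T := by field_simp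
    rw [h3, Real.log_div hc.ne' hT.ne']
    ring
  refine Filter.Tendsto.congr' h1 ?_
  refine tendsto_finsetSum _ fun i _ => tendsto_finsetSum _ fun j _ => ?_
  rcases (hp i).eq_or_lt with h | h
  · simp [← h]
  · refine ((Filter.Tendsto.sub_const ?_ _).const_mul _).const_mul _
    refine (Real.continuousAt_log h.ne').tendsto.comp ?_
    simpa using (Filter.Tendsto.const_div_atTop Filter.tendsto_id (q j)).add_const (p i)

/-- An inequality of integrands integrates to one of truncated integrals. Equal traces make the
divergent `log T` terms agree, so the inequality survives the limit. -/
theorem spectralRelEnt_le {m : Type*} [Fintype m] [DecidableEq m]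
    {U W : unitaryGroup n ℂ} {p q : n → ℝ} {U' W' : unitaryGroup m ℂ} {p' q' : m → ℝ}
    (hp : ∀ i, 0 ≤ p i) (hq : ∀ i, 0 < q i) (hp' : ∀ i, 0 ≤ p' i) (hq' : ∀ i, 0 < q' i)
    (htr : ∑ i, p' i = ∑ i, p i)
    (h : ∀ t, 0 ≤ t → relEntIntegrand t U' W' p' q' ≤ relEntIntegrand t U W p q) :
    spectralRelEnt U' W' p' q' ≤ spectralRelEnt U W p q := by
  refine le_of_tendsto_of_tendsto (tendsto_relEntTruncated U' W' hp' hq')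
    (tendsto_relEntTruncated U W hp hq) ?_
  filter_upwards [Filter.eventually_ge_atTop 0] with T hT
  rw [htr]
  have hd : ∀ t, 0 ≤ t → HasDerivAt (fun s => relEntTruncated U W p q s -
      relEntTruncated U' W' p' q' s)
      (relEntIntegrand t U W p q - relEntIntegrand t U' W' p' q') t := fun t ht =>
    (hasDerivAt_relEntTruncated ht U W hp hq).sub (hasDerivAt_relEntTruncated ht U' W' hp' hq')
  have hm : MonotoneOn (fun s => relEntTruncated U W p q s - relEntTruncated U' W' p' q' s)
      (Set.Ici 0) := by
    refine monotoneOn_of_deriv_nonneg (convex_Ici 0)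
      (fun t ht => (hd t ht).continuousAt.continuousWithinAt)
      (fun t ht => ?_) fun t ht => ?_
    · rw [interior_Ici] at ht
      exact (hd t ht.le).differentiableAt.differentiableWithinAt
    · rw [interior_Ici] at ht
      rw [(hd t ht.le).deriv]
      linarith [h t ht.le]
  -- Both truncated integrals vanish at `0`, so monotonicity of their difference is the wanted
  -- inequality.
  have := hm Set.self_mem_Ici hT hT
  simp only [relEntTruncated, zero_mul, add_zero, sub_self, mul_zero, sum_const_zero] at this ⊢
  linarith

end Spectral

/-! ### Entropy of unnormalised positive matrices. -/

section VonNeumann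

variable {m n b : Type*} [Fintype m] [DecidableEq m] [Fintype n] [DecidableEq n]
  [Fintype b] [DecidableEq b]

/-- The von Neumann entropy `-Tr M log M` in nats of a positive matrix that need not be
normalised. -/
def vonNeumann (M : Matrix n n ℂ) : ℝ :=
  (M.charpoly.roots.map fun z => Real.negMulLog z.re).sum

theorem charpoly_spectralMatrix (U : unitaryGroup n ℂ) (p : n → ℝ) :
    (spectralMatrix U p).charpoly = ∏ i, (Polynomial.X - Polynomial.C (p i : ℂ)) := by
  rw [spectralMatrix, charpoly_mul_comm, ← Matrix.mul_assoc, unitary_conjTranspose_mul_self,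
    Matrix.one_mul, charpoly_diagonal]

theorem vonNeumann_spectralMatrix (U : unitaryGroup n ℂ) (p : n → ℝ) :
    vonNeumann (spectralMatrix U p) = ∑ i, Real.negMulLog (p i) := by
  have : (spectralMatrix U p).charpoly.roots = univ.val.map fun i => (p i : ℂ) := by
    rw [charpoly_spectralMatrix, Polynomial.roots_prod]
    · simp
    · simp [prod_ne_zero_iff, Polynomial.X_sub_C_ne_zero]
  rw [vonNeumann, this, Multiset.map_map]
  simp

theorem IsHermitian.vonNeumann_eq {A : Matrix n n ℂ} (hA : A.IsHermitian) :
    vonNeumann A = ∑ i, Real.negMulLog (hA.eigenvalues i) := by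
  conv_lhs => rw [hA.eq_spectralMatrix]
  exact vonNeumann_spectralMatrix _ _

theorem spectralMatrix_one (p : n → ℝ) :
    spectralMatrix 1 p = diagonal fun i => (p i : ℂ) := by
  simp [spectralMatrix]

theorem vonNeumann_diagonal (p : n → ℝ) :
    vonNeumann (diagonal fun i => (p i : ℂ)) = ∑ i, Real.negMulLog (p i) := by
  rw [← spectralMatrix_one, vonNeumann_spectralMatrix]

theorem vonNeumann_submatrix (M : Matrix n n ℂ) (e : m ≃ n) :
    vonNeumann (M.submatrix e e) = vonNeumann M := by
  rw [vonNeumann, vonNeumann, show M.submatrix e e = reindex e.symm e.symm M from rfl,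
    charpoly_reindex]

/-- The characteristic polynomials of `V (M Vᴴ)` and `(M Vᴴ) V = M` differ only by powers of the
variable, and extra zero eigenvalues carry no entropy. -/
theorem vonNeumann_isometry {V : Matrix m n ℂ} (hV : Vᴴ * V = 1) (M : Matrix n n ℂ) :
    vonNeumann (V * M * Vᴴ) = vonNeumann M := by
  have h := charpoly_mul_comm' V (M * Vᴴ)
  rw [Matrix.mul_assoc M, hV, Matrix.mul_one, ← Matrix.mul_assoc] at h
  have h2 := congrArg (fun P : Polynomial ℂ =>
    (P.roots.map fun z => Real.negMulLog z.re).sum) h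
  rw [Polynomial.roots_mul (mul_ne_zero (pow_ne_zero _ Polynomial.X_ne_zero)
      (charpoly_monic _).ne_zero),
    Polynomial.roots_mul (mul_ne_zero (pow_ne_zero _ Polynomial.X_ne_zero)
      (charpoly_monic _).ne_zero)] at h2
  simpa [vonNeumann, Multiset.map_nsmul, Multiset.sum_nsmul] using h2

theorem spectralMatrix_add_smul_one (U : unitaryGroup n ℂ) (p : n → ℝ) (c : ℝ) :
    spectralMatrix U p + (c : ℂ) • 1 = spectralMatrix U fun i => p i + c := by
  have : (c : ℂ) • (1 : Matrix n n ℂ) = spectralMatrix U fun _ => c := by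
    rw [spectralMatrix, ← smul_one_eq_diagonal, Matrix.mul_smul, Matrix.mul_one, Matrix.smul_mul,
      unitary_mul_conjTranspose_self]
  rw [this, spectralMatrix, spectralMatrix, spectralMatrix, ← Matrix.add_mul, ← Matrix.mul_add,
    diagonal_add]
  simp

theorem posSemidef_spectralMatrix (U : unitaryGroup n ℂ) {p : n → ℝ} (hp : ∀ i, 0 ≤ p i) :
    (spectralMatrix U p).PosSemidef :=
  (PosSemidef.diagonal fun i => Complex.zero_le_real.mpr (hp i)).mul_mul_conjTranspose_same _

theorem smul_spectralMatrix (U : unitaryGroup n ℂ) (p : n → ℝ) (c : ℝ) :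
    (c : ℂ) • spectralMatrix U p = spectralMatrix U fun i => c * p i := by
  rw [spectralMatrix, spectralMatrix, ← Matrix.smul_mul, ← Matrix.mul_smul, ← diagonal_smul]
  congr; ext; simp

/-- This removes positive definiteness from the entropy inequalities. The factor `c` is there
because a partial trace turns `ε • 1` into a multiple of it. -/
theorem IsHermitian.tendsto_vonNeumann {A : Matrix n n ℂ} (hA : A.IsHermitian) (c : ℝ) :
    Filter.Tendsto (fun ε : ℝ => vonNeumann (A + ((c * ε : ℝ) : ℂ) • 1))
      (nhdsWithin 0 (Set.Ioi 0)) (nhds (vonNeumann A)) := by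
  have h : ∀ ε : ℝ, vonNeumann (A + ((c * ε : ℝ) : ℂ) • 1) =
      ∑ i, Real.negMulLog (hA.eigenvalues i + c * ε) := fun ε => by
    conv_lhs => rw [hA.eq_spectralMatrix, spectralMatrix_add_smul_one]
    exact vonNeumann_spectralMatrix _ _
  simp only [h]
  have hc : Continuous fun ε : ℝ => ∑ i, Real.negMulLog (hA.eigenvalues i + c * ε) :=
    continuous_finsetSum _ fun i _ => Real.continuous_negMulLog.comp (by fun_prop)
  have := (hc.tendsto 0).mono_left (nhdsWithin_le_nhds (s := Set.Ioi 0))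
  simpa [hA.vonNeumann_eq] using this

theorem IsHermitian.trace_eq_sum {A : Matrix n n ℂ} (hA : A.IsHermitian) :
    (trace A).re = ∑ i, hA.eigenvalues i := by
  rw [hA.trace_eq_sum_eigenvalues]
  simp

theorem IsHermitian.vonNeumann_smul {A : Matrix n n ℂ} (hA : A.IsHermitian) (c : ℝ) :
    vonNeumann ((c : ℂ) • A) = c * vonNeumann A + Real.negMulLog c * (trace A).re := by
  conv_lhs => rw [hA.eq_spectralMatrix, smul_spectralMatrix]
  rw [vonNeumann_spectralMatrix, hA.vonNeumann_eq, hA.trace_eq_sum, mul_sum, mul_sum,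
    ← sum_add_distrib]
  refine sum_congr rfl fun i _ => ?_
  rw [Real.negMulLog_mul]; ring

theorem IsHermitian.cfc_log_eq {A : Matrix n n ℂ} (hA : A.IsHermitian) :
    cfc Real.log A =
      spectralMatrix hA.eigenvectorUnitary fun i => Real.log (hA.eigenvalues i) := by
  rw [hA.cfc_eq]
  rfl

theorem trace_spectralMatrix_mul_same (U : unitaryGroup n ℂ) (p q : n → ℝ) :
    (trace (spectralMatrix U p * spectralMatrix U q)).re = ∑ i, p i * q i := by
  rw [trace_spectralMatrix_mul_spectralMatrix]
  refine sum_congr rfl fun i _ => ?_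
  rw [sum_eq_single i]
  · simp [overlap, unitary_conjTranspose_mul_self]
  · intro j _ hj
    simp [overlap, unitary_conjTranspose_mul_self, one_apply_ne hj.symm]
  · simp

theorem IsHermitian.re_trace_mul_cfc_log {A : Matrix n n ℂ} (hA : A.IsHermitian) :
    (trace (A * cfc Real.log A)).re = -vonNeumann A := by
  rw [hA.cfc_log_eq]
  conv_lhs => enter [1, 1, 1]; rw [hA.eq_spectralMatrix]
  rw [trace_spectralMatrix_mul_same, hA.vonNeumann_eq, ← sum_neg_distrib]
  exact sum_congr rfl fun i _ => by rw [Real.negMulLog]; ring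

/-- The unitary `⨁ k, U k`. -/
def blockDiagonalUnitary (U : b → unitaryGroup n ℂ) : unitaryGroup (n × b) ℂ :=
  ⟨blockDiagonal fun k => (U k : Matrix n n ℂ), by
    rw [mem_unitaryGroup_iff, star_eq_conjTranspose, blockDiagonal_conjTranspose,
      ← blockDiagonal_mul]
    simp only [unitary_mul_conjTranspose_self]
    exact blockDiagonal_one⟩

theorem blockDiagonal_spectralMatrix (U : b → unitaryGroup n ℂ) (p : b → n → ℝ) :
    blockDiagonal (fun k => spectralMatrix (U k) (p k)) =
      spectralMatrix (blockDiagonalUnitary U) fun i => p i.2 i.1 := by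
  rw [spectralMatrix, blockDiagonalUnitary, blockDiagonal_conjTranspose]
  have : (diagonal fun i : n × b => ((p i.2 i.1 : ℝ) : ℂ)) =
      blockDiagonal fun k => diagonal fun i => (p k i : ℂ) :=
    (blockDiagonal_diagonal fun k i => (p k i : ℂ)).symm
  rw [this, ← blockDiagonal_mul, ← blockDiagonal_mul]
  rfl

theorem vonNeumann_blockDiagonal {N : b → Matrix n n ℂ} (hN : ∀ k, (N k).IsHermitian) :
    vonNeumann (blockDiagonal N) = ∑ k, vonNeumann (N k) := by
  have : blockDiagonal N = blockDiagonal fun k =>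
      spectralMatrix (hN k).eigenvectorUnitary (hN k).eigenvalues :=
    congrArg _ (funext fun k => (hN k).eq_spectralMatrix)
  rw [this, blockDiagonal_spectralMatrix, vonNeumann_spectralMatrix, Fintype.sum_prod_type_right]
  exact sum_congr rfl fun k _ => ((hN k).vonNeumann_eq).symm

omit [DecidableEq n] in
theorem trace_mul_blockDiagonal (M : Matrix (n × b) (n × b) ℂ) (L : b → Matrix n n ℂ) :
    trace (M * blockDiagonal L) = ∑ k, trace (blockDiag M k * L k) := by
  simp only [trace, diag, mul_apply, Fintype.sum_prod_type, blockDiagonal_apply, mul_ite, mul_zero,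
    sum_ite_eq', mem_univ, if_true, blockDiag_apply]
  exact sum_comm

end VonNeumann

/-! ### Monotonicity of relative entropy. -/

section DataProcessing

variable {m n b c κ : Type*} [Fintype m] [DecidableEq m] [Fintype n] [DecidableEq n]
  [Fintype b] [DecidableEq b] [Fintype c] [DecidableEq c] [Fintype κ]

theorem spectralRelEnt_eq (U W : unitaryGroup n ℂ) (p q : n → ℝ) :
    spectralRelEnt U W p q = -vonNeumann (spectralMatrix U p) -
      (trace (spectralMatrix U p * spectralMatrix W fun i => Real.log (q i))).re := by
  rw [vonNeumann_spectralMatrix, trace_spectralMatrix_mul_spectralMatrix, spectralRelEnt,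
    ← sum_neg_distrib, ← sum_sub_distrib]
  refine sum_congr rfl fun i _ => ?_
  have : -Real.negMulLog (p i) = ∑ j, overlap U W i j * (p i * Real.log (p i)) := by
    rw [← sum_mul, sum_overlap_right, Real.negMulLog]; ring
  rw [this, ← sum_sub_distrib]
  exact sum_congr rfl fun j _ => by ring

/-- Monotonicity of the relative entropy under trace-preserving completely positive maps,
for a second argument that is block diagonal. -/
theorem relEnt_blockDiagonal_krausMap_le {V : κ → Matrix (m × c) (n × b) ℂ}
    (hV : ∑ k, (V k)ᴴ * V k = 1) {ρ : Matrix (n × b) (n × b) ℂ} (hρ : ρ.PosSemidef)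
    {N : b → Matrix n n ℂ} (hN : ∀ k, (N k).PosDef)
    {N' : c → Matrix m m ℂ} (hN' : ∀ k, (N' k).PosDef)
    (h : krausMap V (blockDiagonal N) = blockDiagonal N') :
    -vonNeumann (krausMap V ρ) -
        ∑ k, (trace (blockDiag (krausMap V ρ) k * cfc Real.log (N' k))).re ≤
      -vonNeumann ρ - ∑ k, (trace (blockDiag ρ k * cfc Real.log (N k))).re := by
  have hρ' := hρ.krausMap V
  set ρ' := krausMap V ρ with hρ'_def
  have e1 : blockDiagonal N = blockDiagonal fun k =>
      spectralMatrix (hN k).1.eigenvectorUnitary (hN k).1.eigenvalues :=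
    congrArg _ (funext fun k => (hN k).1.eq_spectralMatrix)
  have e2 : blockDiagonal N' = blockDiagonal fun k =>
      spectralMatrix (hN' k).1.eigenvectorUnitary (hN' k).1.eigenvalues :=
    congrArg _ (funext fun k => (hN' k).1.eq_spectralMatrix)
  rw [blockDiagonal_spectralMatrix] at e1 e2
  have hq : ∀ i : n × b, 0 < (hN i.2).1.eigenvalues i.1 := fun i => (hN i.2).eigenvalues_pos i.1
  have hq' : ∀ i : m × c, 0 < (hN' i.2).1.eigenvalues i.1 := fun i =>
    (hN' i.2).eigenvalues_pos i.1
  have key := spectralRelEnt_le (U := hρ.1.eigenvectorUnitary)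
    (W := blockDiagonalUnitary fun k => (hN k).1.eigenvectorUnitary)
    (U' := hρ'.1.eigenvectorUnitary)
    (W' := blockDiagonalUnitary fun k => (hN' k).1.eigenvectorUnitary)
    hρ.eigenvalues_nonneg hq hρ'.eigenvalues_nonneg hq' ?_ ?_
  · rw [spectralRelEnt_eq, spectralRelEnt_eq, ← IsHermitian.eq_spectralMatrix,
      ← IsHermitian.eq_spectralMatrix,
      ← blockDiagonal_spectralMatrix _ (fun k i => Real.log ((hN k).1.eigenvalues i)),
      ← blockDiagonal_spectralMatrix _ (fun k i => Real.log ((hN' k).1.eigenvalues i)),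
      trace_mul_blockDiagonal, trace_mul_blockDiagonal, Complex.re_sum, Complex.re_sum] at key
    simpa only [(hN _).1.cfc_log_eq, (hN' _).1.cfc_log_eq] using key
  · rw [← hρ'.1.trace_eq_sum, ← hρ.1.trace_eq_sum, hρ'_def, trace_krausMap hV]
  · intro t ht
    -- The maximiser for the output pair, pulled back by the dual map, is a competitor for the input
    -- pair.
    obtain ⟨Y, hY⟩ := exists_relEntForm_eq_relEntIntegrand ht hρ'.1.eigenvectorUnitary
      (blockDiagonalUnitary fun k => (hN' k).1.eigenvectorUnitary) hρ'.eigenvalues_nonneg hq'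
    rw [← hY, ← e2, ← IsHermitian.eq_spectralMatrix, ← h, hρ'_def]
    have hpos : (blockDiagonal N).PosSemidef := by
      rw [e1]
      exact posSemidef_spectralMatrix _ fun i => (hq i).le
    refine (relEntForm_krausMap_le hV ht hρ hpos Y).trans ?_
    conv_lhs => rw [hρ.1.eq_spectralMatrix, e1]
    exact relEntForm_le_relEntIntegrand ht _ _ hρ.eigenvalues_nonneg hq _

end DataProcessing

/-! ### Partial traces and positivity. -/

section PartialTrace

variable {n b : Type*} [Fintype n] [DecidableEq n] [Fintype b] [DecidableEq b]

/-- The partial trace over the second factor. -/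
def traceRight (M : Matrix (n × b) (n × b) ℂ) : Matrix n n ℂ :=
  ∑ k, blockDiag M k

theorem traceRight_apply (M : Matrix (n × b) (n × b) ℂ) (i j : n) :
    traceRight M i j = ∑ k, M (i, k) (j, k) := by
  simp [traceRight, sum_apply, blockDiag_apply]

theorem PosSemidef.blockDiag {M : Matrix (n × b) (n × b) ℂ} (hM : M.PosSemidef) (k : b) :
    (blockDiag M k).PosSemidef :=
  hM.submatrix fun i => (i, k)

theorem PosDef.blockDiag {M : Matrix (n × b) (n × b) ℂ} (hM : M.PosDef) (k : b) :
    (blockDiag M k).PosDef :=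
  hM.submatrix (e := fun i => (i, k)) fun _ _ h => congrArg Prod.fst h

theorem PosSemidef.traceRight {M : Matrix (n × b) (n × b) ℂ} (hM : M.PosSemidef) :
    (traceRight M).PosSemidef :=
  posSemidef_sum _ fun k _ => hM.blockDiag k

theorem PosDef.traceRight [Nonempty b] {M : Matrix (n × b) (n × b) ℂ} (hM : M.PosDef) :
    (traceRight M).PosDef :=
  posDef_sum univ_nonempty fun k _ => hM.blockDiag k

theorem PosSemidef.add_smul_one {M : Matrix n n ℂ} (hM : M.PosSemidef) {ε : ℝ} (hε : 0 < ε) :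
    (M + (ε : ℂ) • 1).PosDef :=
  PosDef.posSemidef_add hM (PosDef.one.smul (Complex.zero_lt_real.mpr hε))

theorem blockDiag_add_smul_one (M : Matrix (n × b) (n × b) ℂ) (c : ℂ) (k : b) :
    blockDiag (M + c • 1) k = blockDiag M k + c • 1 := by
  ext i j
  simp [blockDiag_apply, one_apply]

theorem traceRight_add_smul_one (M : Matrix (n × b) (n × b) ℂ) (c : ℝ) :
    traceRight (M + (c : ℂ) • 1) = traceRight M + ((Fintype.card b * c : ℝ) : ℂ) • 1 := by
  simp only [traceRight, blockDiag_add_smul_one, sum_add_distrib, sum_const, card_univ]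
  congr 1
  rw [← Nat.cast_smul_eq_nsmul ℂ, smul_smul]
  push_cast
  rfl

theorem trace_traceRight (M : Matrix (n × b) (n × b) ℂ) : trace (traceRight M) = trace M := by
  simp [trace, traceRight_apply, Fintype.sum_prod_type]

end PartialTrace

/-! ### Strong subadditivity. -/

section StrongSubadditivity

variable {A B E : Type*} [Fintype A] [DecidableEq A] [Fintype B] [DecidableEq B]
  [Fintype E] [DecidableEq E]

/-- The Kraus operators of the partial trace over `A`. -/
def traceLeftKraus (a : A) : Matrix (E × B) ((A × E) × B) ℂ :=
  of fun i j => if j = ((a, i.1), i.2) then 1 else 0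

/-- The partial trace over the first of three factors. -/
def traceFirst (M : Matrix ((A × E) × B) ((A × E) × B) ℂ) : Matrix (E × B) (E × B) ℂ :=
  ∑ a, M.submatrix (fun i => ((a, i.1), i.2)) (fun i => ((a, i.1), i.2))

theorem krausMap_traceLeftKraus (M : Matrix ((A × E) × B) ((A × E) × B) ℂ) :
    krausMap traceLeftKraus M = traceFirst M := by
  refine sum_congr rfl fun a _ => ?_
  ext i j
  simp [mul_apply, traceLeftKraus]

theorem sum_traceLeftKraus :
    ∑ a : A, (traceLeftKraus a : Matrix (E × B) ((A × E) × B) ℂ)ᴴ *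
      (traceLeftKraus a : Matrix (E × B) ((A × E) × B) ℂ) = 1 := by
  ext ⟨⟨a, e⟩, b⟩ ⟨⟨a', e'⟩, b'⟩
  have h : ∀ (x : A) (y : E × B), ((a, e), b) = ((x, y.1), y.2) ↔ x = a ∧ y = (e, b) := by
    rintro x ⟨y, z⟩
    simp only [Prod.mk.injEq]
    tauto
  simp only [sum_apply, mul_apply, conjTranspose_apply, traceLeftKraus, of_apply, h]
  rw [sum_eq_single a, sum_eq_single (e, b)]
  · simp [one_apply, eq_comm]
  · intro y _ hy
    simp [hy]
  · simp
  · intro x _ hx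
    simp [hx]
  · simp

theorem traceFirst_blockDiagonal (N : Matrix (A × E) (A × E) ℂ) :
    traceFirst (blockDiagonal fun _ : B => N) = blockDiagonal fun _ : B =>
      traceRight (N.submatrix Prod.swap Prod.swap) := by
  ext ⟨e, b⟩ ⟨e', b'⟩
  simp only [traceFirst, sum_apply, submatrix_apply, blockDiagonal_apply, traceRight_apply,
    Prod.swap]
  split_ifs <;> simp

theorem traceRight_traceFirst (M : Matrix ((A × E) × B) ((A × E) × B) ℂ) :
    traceRight (traceFirst M) =
      traceRight ((traceRight M).submatrix Prod.swap Prod.swap) := by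
  ext e e'
  simp only [traceFirst, traceRight_apply, sum_apply, submatrix_apply, Prod.swap]
  exact sum_comm

theorem PosSemidef.traceFirst {M : Matrix ((A × E) × B) ((A × E) × B) ℂ} (hM : M.PosSemidef) :
    (traceFirst M).PosSemidef :=
  posSemidef_sum _ fun _ _ => hM.submatrix _

theorem traceFirst_add_smul_one (M : Matrix ((A × E) × B) ((A × E) × B) ℂ) (c : ℝ) :
    traceFirst (M + (c : ℂ) • 1) = traceFirst M + ((Fintype.card A * c : ℝ) : ℂ) • 1 := by
  ext i j
  simp only [traceFirst, sum_apply, submatrix_apply, add_apply, smul_apply, one_apply,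
    sum_add_distrib, Prod.mk.injEq, true_and]
  simp [Prod.ext_iff]

/-- The relative entropy of `ρ` to `ρ^{AE} ⊗ 1` is `S(AE) - S(AEB)`. Tracing out `A` sends the
reference to `ρ^E ⊗ 1`, and the relative entropy can only decrease, to `S(E) - S(EB)`. -/
theorem vonNeumann_strong_subadditivity_of_posDef [Nonempty A] [Nonempty B]
    {ρ : Matrix ((A × E) × B) ((A × E) × B) ℂ} (hρ : ρ.PosDef) :
    vonNeumann ρ + vonNeumann (traceRight (traceFirst ρ)) ≤
      vonNeumann (traceRight ρ) + vonNeumann (traceFirst ρ) := by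
  have hAE : (traceRight ρ).PosDef := hρ.traceRight
  have hE : (traceRight (traceFirst ρ)).PosDef := by
    rw [traceRight_traceFirst]
    exact (hAE.submatrix Prod.swap_injective).traceRight
  have key := relEnt_blockDiagonal_krausMap_le (V := traceLeftKraus) sum_traceLeftKraus
    hρ.posSemidef (N := fun _ : B => traceRight ρ) (N' := fun _ : B => traceRight (traceFirst ρ))
    (fun _ => hAE) (fun _ => hE)
    (by rw [krausMap_traceLeftKraus, traceFirst_blockDiagonal, traceRight_traceFirst])
  rw [krausMap_traceLeftKraus, ← Complex.re_sum, ← Complex.re_sum, ← trace_sum, ← trace_sum,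
    ← Matrix.sum_mul, ← Matrix.sum_mul] at key
  have h1 := hAE.1.re_trace_mul_cfc_log
  have h2 := hE.1.re_trace_mul_cfc_log
  rw [traceRight] at h1 h2
  change _ - (trace ((∑ k, blockDiag (traceFirst ρ) k) *
    cfc Real.log (∑ k, blockDiag (traceFirst ρ) k))).re ≤
    _ - (trace ((∑ k, blockDiag ρ k) * cfc Real.log (∑ k, blockDiag ρ k))).re at key
  rw [h1, h2] at key
  simp only [traceRight]
  linarith

/-- Strong subadditivity of the von Neumann entropy. -/
theorem vonNeumann_strong_subadditivity [Nonempty A] [Nonempty B]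
    {ρ : Matrix ((A × E) × B) ((A × E) × B) ℂ} (hρ : ρ.PosSemidef) :
    vonNeumann ρ + vonNeumann (traceRight (traceFirst ρ)) ≤
      vonNeumann (traceRight ρ) + vonNeumann (traceFirst ρ) := by
  have h1 := hρ.1.tendsto_vonNeumann 1
  have h2 := hρ.traceFirst.traceRight.1.tendsto_vonNeumann (Fintype.card B * Fintype.card A)
  have h3 := hρ.traceRight.1.tendsto_vonNeumann (Fintype.card B)
  have h4 := hρ.traceFirst.1.tendsto_vonNeumann (Fintype.card A)
  refine le_of_tendsto_of_tendsto (h1.add h2) (h3.add h4) ?_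
  filter_upwards [self_mem_nhdsWithin] with ε hε
  have key := vonNeumann_strong_subadditivity_of_posDef (hρ.add_smul_one hε)
  rw [traceFirst_add_smul_one, traceRight_add_smul_one, traceRight_add_smul_one,
    ← mul_assoc] at key
  simpa only [one_mul] using key

end StrongSubadditivity

/-! ### The entropic uncertainty relation with quantum side information. -/

section Uncertainty

variable {ι E : Type*} [Fintype ι] [DecidableEq ι] [Fintype E] [DecidableEq E]

/-- The Kraus operators of the measurement of the second factor in the basis formed by the
complex conjugates of the columns of `U`, with the outcome recorded. -/
def measureKraus (U : Matrix ι ι ℂ) (x : ι) : Matrix (E × ι) (E × ι) ℂ :=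
  of fun i j => if i.2 = x ∧ i.1 = j.1 then U j.2 x else 0

/-- The unnormalised state of the first factor after the outcome `x` of this measurement. -/
def measureBlock (U : Matrix ι ι ℂ) (ω : Matrix (E × ι) (E × ι) ℂ) (x : ι) : Matrix E E ℂ :=
  of fun e e' => ∑ c, ∑ c', U c x * ω (e, c) (e', c') * star (U c' x)

theorem sum_measureKraus {U : Matrix ι ι ℂ} (hU : U * Uᴴ = 1) :
    ∑ x, (measureKraus U x : Matrix (E × ι) (E × ι) ℂ)ᴴ *
      (measureKraus U x : Matrix (E × ι) (E × ι) ℂ) = 1 := by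
  ext ⟨e, c⟩ ⟨e', c'⟩
  have h := congrFun (congrFun hU c') c
  simp only [mul_apply, conjTranspose_apply] at h
  simp only [sum_apply, mul_apply, conjTranspose_apply, measureKraus, of_apply,
    Fintype.sum_prod_type]
  have h1 : ∀ x : ι, ∑ f : E, ∑ y : ι, star (if y = x ∧ f = e then U c x else 0) *
      (if y = x ∧ f = e' then U c' x else 0) = if e = e' then U c' x * star (U c x) else 0 := by
    intro x
    rw [sum_eq_single e, sum_eq_single x]
    · split_ifs <;> simp_all [mul_comm]
    · intro y _ hy
      simp [hy]
    · simp
    · intro f _ hf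
      simp [hf]
    · simp
  simp only [h1]
  split_ifs with he
  · rw [h]; simp [one_apply, he, eq_comm]
  · simp [he]

theorem krausMap_measureKraus (U : Matrix ι ι ℂ) (ω : Matrix (E × ι) (E × ι) ℂ) :
    krausMap (measureKraus U) ω = blockDiagonal (measureBlock U ω) := by
  ext ⟨e, y⟩ ⟨e', y'⟩
  have h1 : ∀ x : ι, ((measureKraus U x : Matrix (E × ι) (E × ι) ℂ) * ω *
      (measureKraus U x : Matrix (E × ι) (E × ι) ℂ)ᴴ) (e, y) (e', y') =
      if y = x ∧ y' = x then measureBlock U ω x e e' else 0 := by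
    intro x
    simp only [mul_apply, conjTranspose_apply, measureKraus, of_apply, Fintype.sum_prod_type,
      measureBlock]
    by_cases hy : y = x <;> by_cases hy' : y' = x <;> simp [hy, hy', sum_mul]
    rw [sum_eq_single e' (fun f _ hf => by simp [hf.symm]) (by simp)]
    simp only [if_true]
    exact sum_comm
  simp only [krausMap, sum_apply, h1, blockDiagonal_apply]
  rw [sum_eq_single y]
  · simp [eq_comm]
  · intro x _ hx
    rw [if_neg fun h => hx h.1.symm]
  · simp

theorem PosSemidef.measureBlock (U : Matrix ι ι ℂ) {ω : Matrix (E × ι) (E × ι) ℂ}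
    (hω : ω.PosSemidef) (x : ι) : (measureBlock U ω x).PosSemidef := by
  have h := (hω.krausMap (measureKraus U)).blockDiag x
  rwa [krausMap_measureKraus, blockDiag_blockDiagonal] at h

theorem sum_measureBlock {U : Matrix ι ι ℂ} (hU : U * Uᴴ = 1) (ω : Matrix (E × ι) (E × ι) ℂ) :
    ∑ x, measureBlock U ω x = traceRight ω := by
  ext e e'
  have h : ∀ c c', ∑ x, U c x * star (U c' x) = if c = c' then 1 else 0 := fun c c' => by
    simpa [mul_apply, one_apply] using congrFun (congrFun hU c) c'
  simp only [sum_apply, measureBlock, of_apply, traceRight_apply]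
  rw [sum_comm]
  refine sum_congr rfl fun c _ => ?_
  rw [sum_comm (s := univ)]
  have : ∀ c', ∑ x, U c x * ω (e, c) (e', c') * star (U c' x) =
      if c = c' then ω (e, c) (e', c') else 0 := fun c' => by
    have := congrArg (fun z => z * ω (e, c) (e', c')) (h c c')
    simp only [sum_mul, ite_mul, one_mul, zero_mul] at this
    rw [← this]
    exact sum_congr rfl fun x _ => by ring
  simp only [this, sum_ite_eq, mem_univ, if_true]

/-- A block diagonal matrix has no coherences in the standard basis, so only the squared moduli of
the entries of `U` enter. When these are constant, every outcome leaves `E` in the same state. -/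
theorem measureBlock_blockDiagonal {U : Matrix ι ι ℂ} {r : ℝ}
    (hU : ∀ c x, U c x * star (U c x) = r) (N : ι → Matrix E E ℂ) (x : ι) :
    measureBlock U (blockDiagonal N) x = (r : ℂ) • ∑ c, N c := by
  ext e e'
  simp only [measureBlock, of_apply, blockDiagonal_apply, smul_apply, sum_apply, smul_eq_mul,
    mul_sum]
  refine sum_congr rfl fun c _ => ?_
  simp only [mul_ite, ite_mul, mul_zero, zero_mul, sum_ite_eq, mem_univ, if_true]
  rw [← hU c x]; ring

theorem measureBlock_add_smul_one {U : Matrix ι ι ℂ} (hU : Uᴴ * U = 1)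
    (ω : Matrix (E × ι) (E × ι) ℂ) (r : ℂ) (x : ι) :
    measureBlock U (ω + r • 1) x = measureBlock U ω x + r • 1 := by
  have h : ∑ c, U c x * star (U c x) = 1 := by
    have := congrFun (congrFun hU x) x
    simp only [mul_apply, conjTranspose_apply, one_apply_eq] at this
    simpa [mul_comm] using this
  ext e e'
  simp only [measureBlock, of_apply, add_apply, smul_apply, one_apply, mul_add, add_mul,
    sum_add_distrib, Prod.mk.injEq]
  congr 1
  by_cases he : e = e'
  · simp only [he, true_and, smul_eq_mul, mul_ite, mul_one, mul_zero, ite_mul, zero_mul,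
      sum_ite_eq, mem_univ, if_true]
    conv_rhs => rw [← mul_one r, ← h, mul_sum]
    exact sum_congr rfl fun c _ => by ring
  · simp [he]

/-- Monotonicity is applied to `ω` and its pinching in the standard basis, under the measurement in
the other basis. The initial relative entropy is the entropy gained by pinching; the pinched
reference becomes `ω^E ⊗ 1/d`, which is where `log d` and the entropy of `ω^E` come from. -/
theorem vonNeumann_uncertainty_of_posDef [Nonempty ι] {U : Matrix ι ι ℂ} (hU : U * Uᴴ = 1)
    (hU' : ∀ c x, U c x * star (U c x) = ((Fintype.card ι : ℝ)⁻¹ : ℝ))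
    {ω : Matrix (E × ι) (E × ι) ℂ} (hω : ω.PosDef) :
    vonNeumann ω + vonNeumann (traceRight ω) + Real.log (Fintype.card ι) * (trace ω).re ≤
      ∑ c, vonNeumann (blockDiag ω c) + ∑ x, vonNeumann (measureBlock U ω x) := by
  have hd : (0 : ℝ) < Fintype.card ι := by exact_mod_cast Fintype.card_pos
  have hE : (traceRight ω).PosDef := hω.traceRight
  set N' : Matrix E E ℂ := (((Fintype.card ι : ℝ)⁻¹ : ℝ) : ℂ) • traceRight ω with hN'_def
  have hN' : N'.PosDef := hE.smul (Complex.zero_lt_real.mpr (inv_pos.mpr hd))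
  have key := relEnt_blockDiagonal_krausMap_le (V := measureKraus U) (sum_measureKraus hU)
    hω.posSemidef (N := blockDiag ω) (N' := fun _ : ι => N') hω.blockDiag (fun _ => hN')
    (by
      rw [krausMap_measureKraus]
      exact congrArg _ (funext fun x => measureBlock_blockDiagonal hU' _ x))
  rw [krausMap_measureKraus, blockDiag_blockDiagonal,
    vonNeumann_blockDiagonal fun x => (hω.posSemidef.measureBlock U x).1,
    ← Complex.re_sum, ← trace_sum, ← Matrix.sum_mul, sum_measureBlock hU] at key
  simp only [fun k => (hω.blockDiag k).1.re_trace_mul_cfc_log, sum_neg_distrib] at key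
  have h1 : traceRight ω = (Fintype.card ι : ℂ) • N' := by
    rw [hN'_def, smul_smul]
    simp
  have h2 : (trace (traceRight ω * cfc Real.log N')).re = -(Fintype.card ι * vonNeumann N') := by
    rw [h1, Matrix.smul_mul, trace_smul, smul_eq_mul, ← Complex.ofReal_natCast,
      Complex.re_ofReal_mul, hN'.1.re_trace_mul_cfc_log, mul_neg]
  have h3 : vonNeumann N' = (Fintype.card ι : ℝ)⁻¹ * vonNeumann (traceRight ω) +
      Real.negMulLog (Fintype.card ι : ℝ)⁻¹ * (trace ω).re := by
    rw [hN'_def, hE.1.vonNeumann_smul, trace_traceRight]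
  rw [h2, h3, Real.negMulLog, Real.log_inv] at key
  have h4 : (Fintype.card ι : ℝ) * ((Fintype.card ι : ℝ)⁻¹ * vonNeumann (traceRight ω) +
      -(Fintype.card ι : ℝ)⁻¹ * -Real.log (Fintype.card ι) * (trace ω).re) =
      vonNeumann (traceRight ω) + Real.log (Fintype.card ι) * (trace ω).re := by
    field_simp
  rw [h4] at key
  linarith

/-- An entropic uncertainty relation with quantum side information, for two mutually unbiased
bases. -/
theorem vonNeumann_uncertainty [Nonempty ι] {U : Matrix ι ι ℂ} (hU : U * Uᴴ = 1)
    (hU' : ∀ c x, U c x * star (U c x) = ((Fintype.card ι : ℝ)⁻¹ : ℝ))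
    {ω : Matrix (E × ι) (E × ι) ℂ} (hω : ω.PosSemidef) :
    vonNeumann ω + vonNeumann (traceRight ω) + Real.log (Fintype.card ι) * (trace ω).re ≤
      ∑ c, vonNeumann (blockDiag ω c) + ∑ x, vonNeumann (measureBlock U ω x) := by
  have h1 := hω.1.tendsto_vonNeumann 1
  have h2 := hω.traceRight.1.tendsto_vonNeumann (Fintype.card ι)
  have h3 := tendsto_finsetSum univ fun c _ => (hω.blockDiag c).1.tendsto_vonNeumann 1
  have h4 := tendsto_finsetSum univ fun x _ => (hω.measureBlock U x).1.tendsto_vonNeumann 1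
  refine le_of_tendsto_of_tendsto ((h1.add h2).add_const _) (h3.add h4) ?_
  filter_upwards [self_mem_nhdsWithin] with ε hε
  have key := vonNeumann_uncertainty_of_posDef hU hU' (hω.add_smul_one hε)
  simp only [blockDiag_add_smul_one, traceRight_add_smul_one,
    measureBlock_add_smul_one (mul_eq_one_comm.mp hU)] at key
  simp only [one_mul]
  refine le_trans ?_ key
  -- The perturbation only increases the trace, and `log d ≥ 0`, so the trace term can be kept at
  -- `ω` and only the entropies pass to the limit.
  have h5 : (trace ω).re ≤ (trace (ω + (ε : ℂ) • 1)).re := by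
    rw [trace_add, trace_smul, trace_one, Complex.add_re, smul_eq_mul, Complex.re_ofReal_mul,
      Complex.natCast_re]
    have : (0 : ℝ) ≤ ε * Fintype.card (E × ι) := mul_nonneg (le_of_lt hε) (Nat.cast_nonneg _)
    linarith
  have h6 : 0 ≤ Real.log (Fintype.card ι) := Real.log_natCast_nonneg _
  have h7 := mul_le_mul_of_nonneg_left h5 h6
  linarith

end Uncertainty

end Matrix

open Matrix Finset

namespace QState

theorem entropy_eq {ι : Type*} [Fintype ι] [DecidableEq ι] (ρ : QState ι) :
    ρ.entropy = vonNeumann ρ.mat / Real.log 2 := by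
  rw [entropy, ρ.posSemidef.isHermitian.vonNeumann_eq, ← sum_neg_distrib, sum_div]
  refine sum_congr rfl fun i _ => ?_
  rw [Real.logb, Real.negMulLog]; ring

/-! ### Nonnegativity of conditional mutual information and of squashed entanglement. -/

section SSA

variable {A B E : Type*} [Fintype A] [DecidableEq A] [Fintype B] [DecidableEq B]
    [Fintype E] [DecidableEq E]

theorem nonempty {ι : Type*} [Fintype ι] (ρ : QState ι) : Nonempty ι := by
  by_contra h
  rw [not_nonempty_iff] at h
  simpa using ρ.trace_eq_one

theorem condMutualInfo_eq (σ : QState ((A × B) × E)) :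
    σ.condMutualInfo = (vonNeumann σ.fstThd.mat + vonNeumann σ.sndThd.mat -
      vonNeumann σ.mat - vonNeumann σ.snd.mat) / Real.log 2 := by
  simp only [condMutualInfo, entropy_eq]
  ring

theorem condMutualInfo_nonneg (σ : QState ((A × B) × E)) : 0 ≤ σ.condMutualInfo := by
  obtain ⟨⟨⟨a, b⟩, e⟩⟩ := σ.nonempty
  have : Nonempty A := ⟨a⟩
  have : Nonempty B := ⟨b⟩
  -- Strong subadditivity is stated with the conditioning system in the middle.
  let f : (A × E) × B ≃ (A × B) × E :=
    { toFun := fun p => ((p.1.1, p.2), p.1.2)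
      invFun := fun q => ((q.1.1, q.2), q.1.2)
      left_inv := fun _ => rfl
      right_inv := fun _ => rfl }
  have key := vonNeumann_strong_subadditivity (σ.posSemidef.submatrix f)
  have h1 : traceRight (σ.mat.submatrix f f) = σ.fstThd.mat := by
    ext i j
    simp only [traceRight_apply, fstThd, marginal, Matrix.sum_apply, submatrix_apply]
    rfl
  have h2 : traceFirst (σ.mat.submatrix f f) =
      σ.sndThd.mat.submatrix (Equiv.prodComm E B) (Equiv.prodComm E B) := by
    ext i j
    simp only [traceFirst, sndThd, marginal, Matrix.sum_apply, submatrix_apply]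
    rfl
  have h3 : traceRight (traceFirst (σ.mat.submatrix f f)) = σ.snd.mat := by
    ext i j
    simp only [traceRight_apply, traceFirst, snd, marginal, Matrix.sum_apply, submatrix_apply,
      Fintype.sum_prod_type]
    rw [sum_comm]
    rfl
  rw [h3, h1, h2, vonNeumann_submatrix, vonNeumann_submatrix] at key
  rw [condMutualInfo_eq]
  exact div_nonneg (by linarith) (Real.log_nonneg one_le_two)

theorem squashedEntanglement_nonneg (ρ : QState (A × B)) : 0 ≤ ρ.squashedEntanglement := by
  refine le_iInf fun n => le_iInf fun σ => le_iInf fun _ => ?_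
  have := σ.condMutualInfo_nonneg
  exact_mod_cast (by positivity : (0 : ℝ) ≤ 1 / 2 * σ.condMutualInfo)

theorem squashedEntanglement_le {n : ℕ} (σ : QState ((A × B) × Fin n)) :
    σ.fst.squashedEntanglement ≤ ((1 / 2 * σ.condMutualInfo : ℝ) : EReal) :=
  iInf_le_of_le n (iInf_le_of_le σ (iInf_le _ rfl))

end SSA

/-! ### Classical states. -/

section Diagonal

/-- The classical state with probability distribution `p`. -/
def ofProb {ι : Type*} [Fintype ι] [DecidableEq ι] (p : ι → ℝ) (hp : ∀ i, 0 ≤ p i)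
    (h1 : ∑ i, p i = 1) : QState ι where
  mat := diagonal fun i => (p i : ℂ)
  posSemidef := PosSemidef.diagonal fun i => Complex.zero_le_real.mpr (hp i)
  trace_eq_one := by rw [trace_diagonal]; exact_mod_cast h1

theorem marginal_ofProb {ι κ μ : Type*} [Fintype ι] [DecidableEq ι] [Fintype κ] [DecidableEq κ]
    [Fintype μ] (e : ι ≃ κ × μ) (p : ι → ℝ) (hp : ∀ i, 0 ≤ p i) (h1 : ∑ i, p i = 1) :
    ((ofProb p hp h1).marginal e).mat = diagonal fun k => ((∑ m, p (e.symm (k, m)) : ℝ) : ℂ) := by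
  ext k l
  simp only [marginal, ofProb, Matrix.sum_apply, submatrix_apply, diagonal_apply,
    EmbeddingLike.apply_eq_iff_eq, Prod.mk.injEq, and_true]
  split_ifs <;> simp

theorem vonNeumann_marginal_ofProb {ι κ μ : Type*} [Fintype ι] [DecidableEq ι] [Fintype κ]
    [DecidableEq κ] [Fintype μ] (e : ι ≃ κ × μ) (p : ι → ℝ) (hp : ∀ i, 0 ≤ p i)
    (h1 : ∑ i, p i = 1) :
    vonNeumann ((ofProb p hp h1).marginal e).mat =
      ∑ k, Real.negMulLog (∑ m, p (e.symm (k, m))) := by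
  rw [marginal_ofProb, vonNeumann_diagonal]

theorem vonNeumann_ofProb {ι : Type*} [Fintype ι] [DecidableEq ι] (p : ι → ℝ)
    (hp : ∀ i, 0 ≤ p i) (h1 : ∑ i, p i = 1) :
    vonNeumann (ofProb p hp h1).mat = ∑ i, Real.negMulLog (p i) :=
  vonNeumann_diagonal p

end Diagonal

end QState

/-! ### The flower state as a normalised projection. -/

section Flower

variable {ι : Type*} [Fintype ι] [DecidableEq ι]

/-- The isometry from the purifying system to the flower state. -/
def flowerIsometry (U : unitaryGroup ι ℂ) : Matrix ((ι × Fin 2) × (ι × Fin 2)) ι ℂ :=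
  of fun w c => if w.2 = w.1 then
    ((Real.sqrt 2 : ℝ) : ℂ)⁻¹ * (flowerUnitary U w.1.2 : Matrix ι ι ℂ) c w.1.1 else 0

theorem inv_sqrt_two_mul_self :
    (((Real.sqrt 2 : ℝ) : ℂ)⁻¹ * ((Real.sqrt 2 : ℝ) : ℂ)⁻¹) = 1 / 2 := by
  rw [← mul_inv, ← Complex.ofReal_mul, Real.mul_self_sqrt zero_le_two]
  norm_num

/-- Each of the two unitaries contributes half of the identity. -/
theorem flowerIsometry_conjTranspose_mul_self (U : unitaryGroup ι ℂ) :
    (flowerIsometry U)ᴴ * flowerIsometry U = 1 := by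
  ext c c'
  simp only [mul_apply, conjTranspose_apply, flowerIsometry, of_apply, Fintype.sum_prod_type]
  have h : ∀ (x : ι) (j : Fin 2), ∑ y : ι, ∑ k : Fin 2,
      star (if (y, k) = (x, j) then ((Real.sqrt 2 : ℝ) : ℂ)⁻¹ *
        (flowerUnitary U j : Matrix ι ι ℂ) c x else 0) *
      (if (y, k) = (x, j) then ((Real.sqrt 2 : ℝ) : ℂ)⁻¹ *
        (flowerUnitary U j : Matrix ι ι ℂ) c' x else 0) =
      1 / 2 * ((flowerUnitary U j : Matrix ι ι ℂ) c' x *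
        star ((flowerUnitary U j : Matrix ι ι ℂ) c x)) := by
    intro x j
    rw [← Fintype.sum_prod_type' (f := fun y k => star (if (y, k) = (x, j) then
        ((Real.sqrt 2 : ℝ) : ℂ)⁻¹ * (flowerUnitary U j : Matrix ι ι ℂ) c x else 0) *
      (if (y, k) = (x, j) then ((Real.sqrt 2 : ℝ) : ℂ)⁻¹ *
        (flowerUnitary U j : Matrix ι ι ℂ) c' x else 0)), sum_eq_single (x, j)]
    · simp only [if_true, star_mul', Complex.star_def, map_inv₀, Complex.conj_ofReal,
        ← inv_sqrt_two_mul_self]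
      ring
    · intro y _ hy
      simp [hy]
    · simp
  simp only [h]
  rw [sum_comm]
  have h2 : ∀ j, ∑ x, 1 / 2 * ((flowerUnitary U j : Matrix ι ι ℂ) c' x *
        star ((flowerUnitary U j : Matrix ι ι ℂ) c x)) = 1 / 2 * (1 : Matrix ι ι ℂ) c' c := by
    intro j
    rw [← mul_sum, ← unitary_mul_conjTranspose_self (flowerUnitary U j)]
    simp only [mul_apply, conjTranspose_apply]
  simp only [h2]
  simp [one_apply, eq_comm]

theorem flowerKet_apply (U : unitaryGroup ι ℂ) (w : (ι × Fin 2) × (ι × Fin 2)) (c : ι) :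
    flowerKet U (w, c) =
      ((Real.sqrt (Fintype.card ι) : ℝ) : ℂ)⁻¹ * flowerIsometry U w c := by
  obtain ⟨q, r⟩ := w
  have : ∑ i : ι, ∑ j : Fin 2, (if ((q, r), c).1 = ((i, j), (i, j)) then
      (flowerUnitary U j : Matrix ι ι ℂ) ((q, r), c).2 i else 0) =
      if r = q then (flowerUnitary U q.2 : Matrix ι ι ℂ) c q.1 else 0 := by
    rw [← Fintype.sum_prod_type' (f := fun i j => if ((q, r), c).1 = ((i, j), (i, j)) then
      (flowerUnitary U j : Matrix ι ι ℂ) ((q, r), c).2 i else 0), sum_eq_single q]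
    · simp
    · intro b _ hb
      rw [if_neg]
      intro h
      exact hb (Prod.ext_iff.mp h).1.symm
    · simp
  rw [flowerKet, this, flowerIsometry, of_apply, Real.sqrt_mul zero_le_two]
  push_cast
  split_ifs
  · rw [mul_inv]; ring
  · simp

/-- The flower vector is `V` applied to half of a maximally entangled pair, so tracing out `C`
leaves the normalised projection onto the range of `V`. -/
theorem flowerState_mat [Nonempty ι] (U : unitaryGroup ι ℂ) :
    (flowerState U).mat =
      (((Fintype.card ι : ℝ)⁻¹ : ℝ) : ℂ) • (flowerIsometry U * (flowerIsometry U)ᴴ) := by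
  ext w w'
  simp only [flowerState, QState.fst, QState.marginal, QState.pure, Matrix.sum_apply,
    submatrix_apply, vecMulVec_apply, Equiv.refl_symm, Equiv.refl_apply, Pi.star_apply,
    flowerKet_apply, Matrix.smul_apply, mul_apply, conjTranspose_apply, smul_eq_mul, mul_sum]
  refine sum_congr rfl fun c _ => ?_
  have : (((Fintype.card ι : ℝ)⁻¹ : ℝ) : ℂ) = ((Real.sqrt (Fintype.card ι) : ℝ) : ℂ)⁻¹ *
      ((Real.sqrt (Fintype.card ι) : ℝ) : ℂ)⁻¹ := by
    rw [← mul_inv, ← Complex.ofReal_mul, Real.mul_self_sqrt (Nat.cast_nonneg _)]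
    push_cast; rfl
  rw [this, star_mul', Complex.star_def, map_inv₀, Complex.conj_ofReal]
  ring

variable {E : Type*} [Fintype E] [DecidableEq E]

/-- The isometry `V ⊗ 1` with the factors of its domain exchanged. -/
def extendIsometry (E : Type*) [DecidableEq E] {w : Type*} (V : Matrix w ι ℂ) :
    Matrix (w × E) (E × ι) ℂ :=
  of fun i j => if i.2 = j.1 then V i.1 j.2 else 0

theorem extendIsometry_mul_mul {w : Type*} (V : Matrix w ι ℂ) (ω : Matrix (E × ι) (E × ι) ℂ)
    (i j : w × E) :
    (extendIsometry E V * ω * (extendIsometry E V)ᴴ) i j =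
      ∑ c, ∑ c', V i.1 c * ω (i.2, c) (j.2, c') * star (V j.1 c') := by
  simp only [mul_apply, conjTranspose_apply, extendIsometry, of_apply, Fintype.sum_prod_type]
  rw [sum_eq_single j.2 (fun f _ hf => by simp [hf.symm]) (by simp)]
  simp only [if_true, ite_mul, zero_mul]
  rw [sum_comm]
  refine sum_congr rfl fun c' _ => ?_
  rw [← sum_mul, sum_eq_single i.2 (fun f _ hf => by simp [hf.symm]) (by simp)]
  simp only [if_true, sum_mul]

theorem extendIsometry_conjTranspose_mul_mul {w : Type*} [Fintype w] (V : Matrix w ι ℂ)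
    (σ : Matrix (w × E) (w × E) ℂ) (i j : E × ι) :
    ((extendIsometry E V)ᴴ * σ * extendIsometry E V) i j =
      ∑ x, ∑ y, star (V x i.2) * σ (x, i.1) (y, j.1) * V y j.2 := by
  simp only [mul_apply, conjTranspose_apply, extendIsometry, of_apply, Fintype.sum_prod_type_right]
  rw [sum_eq_single j.1 (fun f _ hf => by simp [hf]) (by simp)]
  simp only [if_true]
  rw [sum_comm]
  refine sum_congr rfl fun y _ => ?_
  rw [← sum_mul, sum_eq_single i.1 (fun f _ hf => by simp [hf]) (by simp)]
  simp only [if_true, sum_mul]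

theorem extendIsometry_conjTranspose_mul_self {w : Type*} [Fintype w] {V : Matrix w ι ℂ}
    (hV : Vᴴ * V = 1) :
    (extendIsometry E V : Matrix (w × E) (E × ι) ℂ)ᴴ *
      (extendIsometry E V : Matrix (w × E) (E × ι) ℂ) = 1 := by
  classical
  ext ⟨e, c⟩ ⟨e', c'⟩
  have h := congrFun (congrFun hV c) c'
  have := extendIsometry_conjTranspose_mul_mul (E := E) V 1 (e, c) (e', c')
  rw [Matrix.mul_one] at this
  rw [this]
  by_cases he : e = e'
  · subst he
    simpa [one_apply, mul_apply] using h
  · simp [one_apply, he]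

open scoped MatrixOrder Matrix.Norms.L2Operator in
/-- A positive matrix that does not lose trace under compression to the range of an isometry `V`
is supported on that range. -/
theorem Matrix.PosSemidef.eq_isometry_conj {m n : Type*} [Fintype m] [DecidableEq m] [Fintype n]
    [DecidableEq n] {V : Matrix m n ℂ} (hV : Vᴴ * V = 1) {σ : Matrix m m ℂ} (hσ : σ.PosSemidef)
    (h : trace (Vᴴ * σ * V) = trace σ) : σ = V * (Vᴴ * σ * V) * Vᴴ := by
  obtain ⟨C, rfl⟩ : ∃ C : Matrix m m ℂ, σ = Cᴴ * C :=
    CStarAlgebra.nonneg_iff_eq_star_mul_self.mp hσ.nonneg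
  have hid : (1 - V * Vᴴ) * (1 - V * Vᴴ) = 1 - V * Vᴴ := by
    have : V * Vᴴ * (V * Vᴴ) = V * Vᴴ := by
      rw [Matrix.mul_assoc, ← Matrix.mul_assoc Vᴴ, hV, Matrix.one_mul]
    rw [Matrix.mul_sub, Matrix.sub_mul, Matrix.sub_mul, this]; simp
  -- Its squared Hilbert-Schmidt norm is the trace lost under compression, which is zero by `h`.
  have hC : C * (1 - V * Vᴴ) = 0 := by
    rw [← trace_conjTranspose_mul_self_eq_zero_iff]
    have hh : (1 - V * Vᴴ)ᴴ = 1 - V * Vᴴ := by simp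
    rw [conjTranspose_mul, hh, Matrix.mul_assoc, trace_mul_comm, Matrix.mul_assoc,
      Matrix.mul_assoc, hid, ← Matrix.mul_assoc, Matrix.mul_sub, trace_sub, Matrix.mul_one,
      ← h, Matrix.mul_assoc, trace_mul_comm Vᴴ, ← Matrix.mul_assoc, sub_self]
  have h1 : C * V * Vᴴ = C := by
    rw [Matrix.mul_sub, Matrix.mul_one, sub_eq_zero] at hC
    rw [Matrix.mul_assoc, ← hC]
  have h2 : V * Vᴴ * Cᴴ = Cᴴ := by
    have := congrArg Matrix.conjTranspose h1
    simpa [Matrix.mul_assoc] using this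
  calc Cᴴ * C = (V * Vᴴ * Cᴴ) * (C * V * Vᴴ) := by rw [h1, h2]
    _ = _ := by simp only [Matrix.mul_assoc]

end Flower

/-! ### Extensions of the flower state and their entropies. -/

section FlowerExtension

variable {ι : Type*} [Fintype ι] [DecidableEq ι] {E : Type*} [Fintype E] [DecidableEq E]

/-- The compression of an extension of the flower state to the purifying system and `E`. -/
def flowerCompression (U : unitaryGroup ι ℂ)
    (σ : QState (((ι × Fin 2) × (ι × Fin 2)) × E)) : Matrix (E × ι) (E × ι) ℂ :=
  (extendIsometry E (flowerIsometry U))ᴴ * σ.mat * extendIsometry E (flowerIsometry U)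

theorem posSemidef_flowerCompression (U : unitaryGroup ι ℂ)
    (σ : QState (((ι × Fin 2) × (ι × Fin 2)) × E)) : (flowerCompression U σ).PosSemidef :=
  σ.posSemidef.conjTranspose_mul_mul_same _

/-- The trace depends only on the reduced state on `AA'BB'`, and that state already lives on the
range of `V`. -/
theorem trace_flowerCompression [Nonempty ι] {U : unitaryGroup ι ℂ}
    {σ : QState (((ι × Fin 2) × (ι × Fin 2)) × E)} (h : σ.fst = flowerState U) :
    trace (flowerCompression U σ) = 1 := by
  have hV := flowerIsometry_conjTranspose_mul_self U
  set V := flowerIsometry U with hVdef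
  have h1 : trace (flowerCompression U σ) = trace (Vᴴ * σ.fst.mat * V) := by
    have h2 : ∀ i : E × ι, flowerCompression U σ i i =
        ∑ x, ∑ y, star (V x i.2) * σ.mat (x, i.1) (y, i.1) * V y i.2 := fun i =>
      extendIsometry_conjTranspose_mul_mul V σ.mat i i
    simp only [trace, Matrix.diag, h2]
    simp only [mul_apply, conjTranspose_apply, QState.fst, QState.marginal, Matrix.sum_apply,
      submatrix_apply, Fintype.sum_prod_type (f := fun i : E × ι => ∑ x, ∑ y,
        star (V x i.2) * σ.mat (x, i.1) (y, i.1) * V y i.2)]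
    rw [sum_comm]
    refine sum_congr rfl fun c _ => ?_
    simp only [mul_sum, sum_mul]
    rw [sum_comm]
    conv_rhs => rw [sum_comm]
    refine sum_congr rfl fun x _ => ?_
    rw [sum_comm]
    rfl
  rw [h1, h, flowerState_mat, Matrix.mul_smul, Matrix.smul_mul, ← hVdef, ← Matrix.mul_assoc, hV,
    Matrix.one_mul, hV, trace_smul, trace_one, smul_eq_mul]
  have : (Fintype.card ι : ℂ) ≠ 0 := by exact_mod_cast Fintype.card_ne_zero
  push_cast
  field_simp

theorem eq_conj_flowerCompression [Nonempty ι] {U : unitaryGroup ι ℂ}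
    {σ : QState (((ι × Fin 2) × (ι × Fin 2)) × E)} (h : σ.fst = flowerState U) :
    σ.mat = extendIsometry E (flowerIsometry U) * flowerCompression U σ *
      (extendIsometry E (flowerIsometry U))ᴴ :=
  σ.posSemidef.eq_isometry_conj
    (extendIsometry_conjTranspose_mul_self (flowerIsometry_conjTranspose_mul_self U))
    ((trace_flowerCompression h).trans σ.trace_eq_one.symm)

variable {U : unitaryGroup ι ℂ} {σ : QState (((ι × Fin 2) × (ι × Fin 2)) × E)}
  {ω : Matrix (E × ι) (E × ι) ℂ}

theorem flower_extension_apply (h : σ.mat = extendIsometry E (flowerIsometry U) * ω *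
      (extendIsometry E (flowerIsometry U))ᴴ) (q r q' r' : ι × Fin 2) (e e' : E) :
    σ.mat ((q, r), e) ((q', r'), e') = if r = q ∧ r' = q' then
      1 / 2 * ∑ c, ∑ c', (flowerUnitary U q.2 : Matrix ι ι ℂ) c q.1 * ω (e, c) (e', c') *
        star ((flowerUnitary U q'.2 : Matrix ι ι ℂ) c' q'.1) else 0 := by
  rw [h, extendIsometry_mul_mul]
  simp only [flowerIsometry, of_apply]
  by_cases h1 : r = q
  · by_cases h2 : r' = q'
    · simp only [h1, h2, and_self, if_true, star_mul', Complex.star_def, map_inv₀,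
        Complex.conj_ofReal, mul_sum, ← inv_sqrt_two_mul_self]
      exact sum_congr rfl fun c _ => sum_congr rfl fun c' _ => by ring
    · simp [h2]
  · simp [h1]

/-- The unnormalised states of `E` after the outcomes `q = (i, j)` of the two measurements. -/
def flowerBlock (U : unitaryGroup ι ℂ) (ω : Matrix (E × ι) (E × ι) ℂ) (q : ι × Fin 2) :
    Matrix E E ℂ :=
  ((1 / 2 : ℝ) : ℂ) • measureBlock (flowerUnitary U q.2 : Matrix ι ι ℂ) ω q.1

/-- `AA'` and `BB'` are perfectly correlated, so tracing out `BB'` destroys the coherences of `AA'`.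
What is left is a classical record of basis and outcome, next to the conditional states of `E`. -/
theorem flower_extension_fstThd (h : σ.mat = extendIsometry E (flowerIsometry U) * ω *
      (extendIsometry E (flowerIsometry U))ᴴ) :
    σ.fstThd.mat = (blockDiagonal (flowerBlock U ω)).submatrix (Equiv.prodComm _ _)
      (Equiv.prodComm _ _) := by
  ext ⟨q, e⟩ ⟨q', e'⟩
  have h0 : σ.fstThd.mat (q, e) (q', e') = ∑ r, σ.mat ((q, r), e) ((q', r), e') := by
    simp only [QState.fstThd, QState.marginal, Matrix.sum_apply, submatrix_apply]
    rfl
  simp only [h0, flower_extension_apply h, submatrix_apply, Equiv.prodComm_apply, Prod.swap,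
    blockDiagonal_apply, flowerBlock, measureBlock, Matrix.smul_apply, of_apply, smul_eq_mul]
  rw [sum_eq_single q]
  · by_cases hq : q = q'
    · subst hq; simp
    · simp [hq]
  · intro r _ hr
    simp [hr]
  · simp

theorem flower_extension_sndThd (h : σ.mat = extendIsometry E (flowerIsometry U) * ω *
      (extendIsometry E (flowerIsometry U))ᴴ) :
    σ.sndThd.mat = (blockDiagonal (flowerBlock U ω)).submatrix (Equiv.prodComm _ _)
      (Equiv.prodComm _ _) := by
  ext ⟨r, e⟩ ⟨r', e'⟩
  have h0 : σ.sndThd.mat (r, e) (r', e') = ∑ q, σ.mat ((q, r), e) ((q, r'), e') := by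
    simp only [QState.sndThd, QState.marginal, Matrix.sum_apply, submatrix_apply]
    rfl
  simp only [h0, flower_extension_apply h, submatrix_apply, Equiv.prodComm_apply, Prod.swap,
    blockDiagonal_apply, flowerBlock, measureBlock, Matrix.smul_apply, of_apply, smul_eq_mul]
  rw [sum_eq_single r]
  · by_cases hr : r = r'
    · subst hr; simp
    · simp [hr, Ne.symm hr]
  · intro q _ hq
    simp [hq.symm]
  · simp

theorem flower_extension_snd (h : σ.mat = extendIsometry E (flowerIsometry U) * ω *
      (extendIsometry E (flowerIsometry U))ᴴ) :
    σ.snd.mat = traceRight ω := by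
  have hV := flowerIsometry_conjTranspose_mul_self U
  ext e e'
  have h0 : σ.snd.mat e e' = ∑ w, σ.mat (w, e) (w, e') := by
    simp only [QState.snd, QState.marginal, Matrix.sum_apply, submatrix_apply]
    rfl
  have hc : ∀ c c', ∑ w, flowerIsometry U w c * star (flowerIsometry U w c') =
      if c' = c then 1 else 0 := fun c c' => by
    have := congrFun (congrFun hV c') c
    simp only [mul_apply, conjTranspose_apply, one_apply] at this
    rw [← this]
    exact sum_congr rfl fun w _ => mul_comm _ _
  simp only [h0, h, extendIsometry_mul_mul, traceRight_apply]
  rw [sum_comm]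
  refine sum_congr rfl fun c _ => ?_
  rw [sum_comm]
  have : ∀ c', ∑ w, flowerIsometry U w c * ω (e, c) (e', c') * star (flowerIsometry U w c') =
      if c' = c then ω (e, c) (e', c') else 0 := fun c' => by
    have := congrArg (fun z => z * ω (e, c) (e', c')) (hc c c')
    simp only [sum_mul, ite_mul, one_mul, zero_mul] at this
    rw [← this]
    exact sum_congr rfl fun x _ => by ring
  simp only [this, sum_ite_eq', mem_univ, if_true]

/-- The blocks of each basis have total trace one before the weight `1/2`, so the choice of basis
contributes exactly the entropy `log 2` of a fair bit. -/
theorem vonNeumann_flowerBlocks (hω : ω.PosSemidef) (htr : trace ω = 1) :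
    vonNeumann (blockDiagonal (flowerBlock U ω)) = Real.log 2 +
      1 / 2 * (∑ c, vonNeumann (measureBlock 1 ω c) + ∑ x, vonNeumann (measureBlock U ω x)) := by
  have hB : ∀ q : ι × Fin 2,
      (measureBlock (flowerUnitary U q.2 : Matrix ι ι ℂ) ω q.1).IsHermitian :=
    fun q => (hω.measureBlock _ _).1
  have hη : Real.negMulLog (1 / 2) = 1 / 2 * Real.log 2 := by
    rw [Real.negMulLog, one_div, Real.log_inv]; ring
  have htr' : ∀ j, ∑ x, (trace (measureBlock (flowerUnitary U j : Matrix ι ι ℂ) ω x)).re = 1 := by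
    intro j
    rw [← Complex.re_sum, ← trace_sum, sum_measureBlock (unitary_mul_conjTranspose_self _),
      trace_traceRight, htr, Complex.one_re]
  have hF : ∀ q, (flowerBlock U ω q).IsHermitian := fun q =>
    ((hω.measureBlock _ _).smul (Complex.zero_le_real.mpr one_half_pos.le)).1
  rw [vonNeumann_blockDiagonal hF]
  simp only [flowerBlock, fun q => (hB q).vonNeumann_smul]
  rw [Fintype.sum_prod_type_right]
  simp only [sum_add_distrib, ← mul_sum, htr', hη, Fin.sum_univ_two]
  simp only [flowerUnitary, if_true, one_ne_zero, if_false]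
  simp only [OneMemClass.coe_one]
  ring

theorem flower_extension_condMutualInfo (h : σ.mat = extendIsometry E (flowerIsometry U) * ω *
      (extendIsometry E (flowerIsometry U))ᴴ) (hω : ω.PosSemidef) (htr : trace ω = 1) :
    σ.condMutualInfo = (2 * Real.log 2 + ∑ c, vonNeumann (measureBlock 1 ω c) +
      ∑ x, vonNeumann (measureBlock U ω x) - vonNeumann ω - vonNeumann (traceRight ω)) /
      Real.log 2 := by
  have h1 : vonNeumann σ.mat = vonNeumann ω := by
    rw [h, vonNeumann_isometry
      (extendIsometry_conjTranspose_mul_self (flowerIsometry_conjTranspose_mul_self U))]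
  rw [QState.condMutualInfo_eq, flower_extension_fstThd h, flower_extension_sndThd h,
    flower_extension_snd h, vonNeumann_submatrix, vonNeumann_flowerBlocks hω htr, h1]
  congr 1
  ring

theorem measureBlock_one (ω : Matrix (E × ι) (E × ι) ℂ) (c : ι) :
    measureBlock 1 ω c = blockDiag ω c := by
  ext e e'
  simp [measureBlock, one_apply, blockDiag_apply]

theorem vonNeumann_smul_one {n : Type*} [Fintype n] [DecidableEq n] (c : ℝ) :
    vonNeumann ((c : ℂ) • (1 : Matrix n n ℂ)) = Fintype.card n * Real.negMulLog c := by
  rw [smul_one_eq_diagonal, vonNeumann_diagonal fun _ => c]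
  simp

end FlowerExtension

/-! ### Squashed entanglement before and after discarding the qubit. -/

section FlowerSquashed

variable {ι : Type*} [Fintype ι] [DecidableEq ι] [Nonempty ι] {U : unitaryGroup ι ℂ}

theorem le_squashedEntanglement_flowerState
    (hU : ∀ c x, (U : Matrix ι ι ℂ) c x * star ((U : Matrix ι ι ℂ) c x) =
      ((Fintype.card ι : ℝ)⁻¹ : ℝ)) :
    ((1 + 1 / 2 * Real.logb 2 (Fintype.card ι) : ℝ) : EReal) ≤
      (flowerState U).squashedEntanglement := by
  refine le_iInf fun n => le_iInf fun σ => le_iInf fun h => ?_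
  rw [EReal.coe_le_coe_iff]
  have hω := posSemidef_flowerCompression U σ
  have htr := trace_flowerCompression h
  rw [flower_extension_condMutualInfo (eq_conj_flowerCompression h) hω htr]
  have key := vonNeumann_uncertainty (unitary_mul_conjTranspose_self U) hU hω
  rw [htr, Complex.one_re, mul_one] at key
  simp only [measureBlock_one]
  have hl : 0 < Real.log 2 := Real.log_pos one_lt_two
  rw [Real.logb, ← sub_nonneg]
  have : ∀ x y : ℝ, 1 / 2 * (x / Real.log 2) - (1 + 1 / 2 * (y / Real.log 2)) =
      (x - 2 * Real.log 2 - y) / (2 * Real.log 2) := fun x y => by field_simp; ring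
  rw [this]
  refine div_nonneg ?_ (by positivity)
  linarith

/-- The flower state as a state on which a one-dimensional system is adjoined. -/
def flowerTrivialExtension (U : unitaryGroup ι ℂ) :
    QState (((ι × Fin 2) × (ι × Fin 2)) × Fin 1) where
  mat := extendIsometry (Fin 1) (flowerIsometry U) * ((((Fintype.card ι : ℝ)⁻¹ : ℝ) : ℂ) • 1) *
    (extendIsometry (Fin 1) (flowerIsometry U))ᴴ
  posSemidef := (PosSemidef.one.smul (Complex.zero_le_real.mpr
    (inv_nonneg.mpr (Nat.cast_nonneg _)))).mul_mul_conjTranspose_same _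
  trace_eq_one := by
    rw [Matrix.mul_smul, Matrix.mul_one, Matrix.smul_mul, trace_smul, trace_mul_comm,
      extendIsometry_conjTranspose_mul_self (flowerIsometry_conjTranspose_mul_self U), trace_one]
    have : (Fintype.card ι : ℂ) ≠ 0 := by exact_mod_cast Fintype.card_ne_zero
    simp [this]

theorem flowerTrivialExtension_fst (U : unitaryGroup ι ℂ) :
    (flowerTrivialExtension U).fst = flowerState U := by
  ext w w'
  rw [flowerState_mat]
  simp only [QState.fst, QState.marginal, flowerTrivialExtension, Matrix.sum_apply,
    submatrix_apply, Equiv.refl_symm, Equiv.refl_apply, extendIsometry_mul_mul]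
  simp only [Fin.sum_univ_one, Matrix.smul_apply, one_apply, Prod.mk.injEq, true_and, smul_eq_mul,
    mul_ite, mul_one, mul_zero, ite_mul, zero_mul, sum_ite_eq, mem_univ, if_true, mul_apply,
    conjTranspose_apply, mul_sum]
  exact sum_congr rfl fun c _ => by ring

/-- Here `ω` is maximally mixed and `E` is trivial: both outcome distributions and `ω` itself have
entropy `log d`, which saturates the uncertainty relation. -/
theorem flowerTrivialExtension_condMutualInfo (U : unitaryGroup ι ℂ) :
    (flowerTrivialExtension U).condMutualInfo = 2 + Real.logb 2 (Fintype.card ι) := by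
  have hd : (Fintype.card ι : ℝ) ≠ 0 := by exact_mod_cast Fintype.card_ne_zero
  have hω :
      ((((Fintype.card ι : ℝ)⁻¹ : ℝ) : ℂ) • (1 : Matrix (Fin 1 × ι) (Fin 1 × ι) ℂ)).PosSemidef :=
    PosSemidef.one.smul (Complex.zero_le_real.mpr (inv_nonneg.mpr (Nat.cast_nonneg _)))
  have htr :
      trace ((((Fintype.card ι : ℝ)⁻¹ : ℝ) : ℂ) • (1 : Matrix (Fin 1 × ι) (Fin 1 × ι) ℂ)) = 1 := by
    have : (Fintype.card ι : ℂ) ≠ 0 := by exact_mod_cast Fintype.card_ne_zero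
    rw [trace_smul, trace_one]
    simp [this]
  rw [flower_extension_condMutualInfo (U := U) rfl hω htr]
  have h1 : ∀ (V : Matrix ι ι ℂ), Vᴴ * V = 1 → ∀ x, measureBlock V
      ((((Fintype.card ι : ℝ)⁻¹ : ℝ) : ℂ) • (1 : Matrix (Fin 1 × ι) (Fin 1 × ι) ℂ)) x =
      (((Fintype.card ι : ℝ)⁻¹ : ℝ) : ℂ) • 1 := by
    intro V hV x
    have h0 : measureBlock V (0 : Matrix (Fin 1 × ι) (Fin 1 × ι) ℂ) x = 0 := by
      ext; simp [measureBlock]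
    simpa [h0] using measureBlock_add_smul_one (E := Fin 1) hV 0
      (((Fintype.card ι : ℝ)⁻¹ : ℝ) : ℂ) x
  have h2 : traceRight ((((Fintype.card ι : ℝ)⁻¹ : ℝ) : ℂ) •
      (1 : Matrix (Fin 1 × ι) (Fin 1 × ι) ℂ)) = ((1 : ℝ) : ℂ) • 1 := by
    have h0 : traceRight (0 : Matrix (Fin 1 × ι) (Fin 1 × ι) ℂ) = 0 := by
      ext; simp [traceRight_apply]
    have := traceRight_add_smul_one (0 : Matrix (Fin 1 × ι) (Fin 1 × ι) ℂ) (Fintype.card ι : ℝ)⁻¹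
    rwa [h0, zero_add, zero_add, mul_inv_cancel₀ hd] at this
  simp only [h1 (1 : Matrix ι ι ℂ) (by simp), h1 U (unitary_conjTranspose_mul_self U), h2,
    vonNeumann_smul_one]
  have hl : Real.log 2 ≠ 0 := (Real.log_pos one_lt_two).ne'
  simp only [sum_const, card_univ, Fintype.card_prod, Fintype.card_fin, Real.log_one,
    nsmul_eq_mul, Real.negMulLog, Real.log_inv, Real.logb, Nat.cast_one, one_mul]
  field_simp
  ring

theorem squashedEntanglement_flowerState
    (hU : ∀ c x, (U : Matrix ι ι ℂ) c x * star ((U : Matrix ι ι ℂ) c x) =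
      ((Fintype.card ι : ℝ)⁻¹ : ℝ)) :
    (flowerState U).squashedEntanglement =
      ((1 + 1 / 2 * Real.logb 2 (Fintype.card ι) : ℝ) : EReal) := by
  refine le_antisymm ?_ (le_squashedEntanglement_flowerState hU)
  have := QState.squashedEntanglement_le (flowerTrivialExtension U)
  rw [flowerTrivialExtension_fst, flowerTrivialExtension_condMutualInfo] at this
  refine this.trans_eq ?_
  congr 1
  ring

/-- The probability distribution of two perfectly correlated copies of a uniform element of `ι`,
a uniform bit and a further copy of the element of `ι`. -/
def flowerProb (ι : Type*) [Fintype ι] [DecidableEq ι] :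
    (ι × (ι × Fin 2)) × Fin (Fintype.card ι) → ℝ :=
  fun p => if p.1.2.1 = p.1.1 ∧ p.2 = Fintype.equivFin ι p.1.1 then
    (2 * Fintype.card ι : ℝ)⁻¹ else 0

theorem flowerProb_nonneg (p) : 0 ≤ flowerProb ι p := by
  unfold flowerProb
  split_ifs <;> positivity

theorem sum_ite_flower {M : Type*} [AddCommMonoid M] (f : ι → Fin 2 → M) :
    ∑ i : ι, ∑ i' : ι, ∑ j : Fin 2, ∑ e : Fin (Fintype.card ι),
      (if i' = i ∧ e = Fintype.equivFin ι i then f i j else 0) = ∑ i, ∑ j, f i j := by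
  refine sum_congr rfl fun i _ => ?_
  simp only [ite_and, sum_ite_irrel, sum_const_zero, sum_ite_eq', mem_univ, if_true]

theorem sum_flowerProb : ∑ p, flowerProb ι p = 1 := by
  have hd : (Fintype.card ι : ℝ) ≠ 0 := by exact_mod_cast Fintype.card_ne_zero
  simp only [Fintype.sum_prod_type, flowerProb]
  rw [sum_ite_flower fun _ _ => (2 * Fintype.card ι : ℝ)⁻¹]
  simp
  field_simp

/-- The extension of the reduced flower state `ρ^{ABB'}` by a copy of the system `A`. -/
def flowerClassicalExtension (ι : Type*) [Fintype ι] [DecidableEq ι] [Nonempty ι] :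
    QState ((ι × (ι × Fin 2)) × Fin (Fintype.card ι)) :=
  QState.ofProb (flowerProb ι) flowerProb_nonneg sum_flowerProb

/-- Tracing out `A'` makes the bit in `B'` classical. For a fixed bit the vectors `U_j |i⟩` of `C`
are orthonormal, so tracing out `C` makes `i` classical as well. No unbiasedness is needed. -/
theorem flowerClassicalExtension_fst (U : unitaryGroup ι ℂ) :
    (flowerClassicalExtension ι).fst = (flowerState U).fstThd := by
  apply QState.ext
  rw [flowerClassicalExtension, QState.fst, QState.marginal_ofProb]
  ext ⟨i, q⟩ ⟨i', q'⟩
  have h0 : (flowerState U).fstThd.mat (i, q) (i', q') =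
      ∑ j, (flowerState U).mat ((i, j), q) ((i', j), q') := by
    simp only [QState.fstThd, QState.marginal, Matrix.sum_apply, submatrix_apply]
    rfl
  have h1 : ∀ j, ∑ c, (flowerUnitary U j : Matrix ι ι ℂ) c i *
      star ((flowerUnitary U j : Matrix ι ι ℂ) c i') = if i' = i then 1 else 0 := fun j => by
    have := congrFun (congrFun (unitary_conjTranspose_mul_self (flowerUnitary U j)) i') i
    simp only [mul_apply, conjTranspose_apply, one_apply] at this
    rw [← this]
    exact sum_congr rfl fun c _ => mul_comm _ _
  have h2 : ∀ j, (flowerState U).mat ((i, j), q) ((i', j), q') =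
      if q = (i, j) ∧ q' = (i', j) then
        (((2 * Fintype.card ι : ℝ)⁻¹ : ℝ) : ℂ) * (if i' = i then 1 else 0) else 0 := by
    intro j
    rw [flowerState_mat, Matrix.smul_apply, mul_apply, smul_eq_mul]
    simp only [conjTranspose_apply, flowerIsometry, of_apply]
    by_cases hq : q = (i, j) <;> by_cases hq' : q' = (i', j)
    · simp only [hq, hq', and_self, if_true, ← h1 j, mul_sum]
      refine sum_congr rfl fun c _ => ?_
      have : (((2 * Fintype.card ι : ℝ)⁻¹ : ℝ) : ℂ) = (((Fintype.card ι : ℝ)⁻¹ : ℝ) : ℂ) *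
        (((Real.sqrt 2 : ℝ) : ℂ)⁻¹ * ((Real.sqrt 2 : ℝ) : ℂ)⁻¹) := by
        rw [inv_sqrt_two_mul_self]; push_cast; rw [mul_inv]; ring
      rw [this, star_mul', Complex.star_def, map_inv₀, Complex.conj_ofReal]
      ring
    all_goals simp [hq, hq']
  rw [h0]
  simp only [h2, diagonal_apply, flowerProb, Equiv.refl_symm, Equiv.refl_apply]
  obtain ⟨a, b⟩ := q
  obtain ⟨a', b'⟩ := q'
  simp only [Prod.mk.injEq]
  by_cases hi : i' = i
  · subst hi
    by_cases ha : a = i'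
    · by_cases ha' : a' = i'
      · subst ha ha'
        fin_cases b <;> fin_cases b' <;> simp
      · simp [ha, ha', Ne.symm ha']
    · simp [ha]
  · simp [hi, Ne.symm hi]

/-- `A` is a function of `E`, hence `S(AE) = S(E)` and `S(ABB'E) = S(BB'E)`; these are `e1` and
`e2`. -/
theorem flowerClassicalExtension_condMutualInfo :
    (flowerClassicalExtension ι).condMutualInfo = 0 := by
  rw [QState.condMutualInfo_eq, flowerClassicalExtension, QState.fstThd, QState.sndThd, QState.snd,
    QState.vonNeumann_marginal_ofProb, QState.vonNeumann_marginal_ofProb,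
    QState.vonNeumann_marginal_ofProb, QState.vonNeumann_ofProb]
  have hd : (Fintype.card ι : ℝ) ≠ 0 := by exact_mod_cast Fintype.card_ne_zero
  have h1 : ∀ (i : ι) (e : Fin (Fintype.card ι)), ∑ q : ι × Fin 2, flowerProb ι ((i, q), e) =
      if e = Fintype.equivFin ι i then (Fintype.card ι : ℝ)⁻¹ else 0 := by
    intro i e
    simp only [flowerProb, Fintype.sum_prod_type, ite_and]
    rw [sum_eq_single i (fun j _ hj => by simp [hj]) (by simp)]
    simp only [if_true]
    split_ifs
    · simp
      field_simp
    · simp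
  have h2 : ∀ (q : ι × Fin 2) (e : Fin (Fintype.card ι)), ∑ i, flowerProb ι ((i, q), e) =
      if e = Fintype.equivFin ι q.1 then (2 * Fintype.card ι : ℝ)⁻¹ else 0 := by
    intro q e
    simp only [flowerProb, ite_and, sum_ite_eq, mem_univ, if_true]
  have h3 : ∀ e : Fin (Fintype.card ι), ∑ p, flowerProb ι (p, e) = (Fintype.card ι : ℝ)⁻¹ := by
    intro e
    rw [Fintype.sum_prod_type]
    simp only [h1]
    rw [← (Fintype.equivFin ι).symm.sum_comp]
    simp
  have e1 : ∑ k : ι × Fin (Fintype.card ι), Real.negMulLog (∑ q, flowerProb ι ((k.1, q), k.2)) =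
      ∑ e : Fin (Fintype.card ι), Real.negMulLog (∑ p, flowerProb ι (p, e)) := by
    simp only [h1, h3, apply_ite Real.negMulLog, Real.negMulLog_zero, Fintype.sum_prod_type,
      sum_ite_eq', mem_univ, if_true]
    simp
  have e2 : ∑ k : (ι × Fin 2) × Fin (Fintype.card ι),
      Real.negMulLog (∑ i, flowerProb ι ((i, k.1), k.2)) =
      ∑ p, Real.negMulLog (flowerProb ι p) := by
    simp only [h2]
    rw [Fintype.sum_prod_type, Fintype.sum_prod_type, Fintype.sum_prod_type]
    simp only [flowerProb, apply_ite Real.negMulLog, Real.negMulLog_zero, Fintype.sum_prod_type]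
    rw [sum_ite_flower fun _ _ => Real.negMulLog (2 * Fintype.card ι : ℝ)⁻¹]
    simp only [sum_ite_eq', mem_univ, if_true]
  refine (div_eq_zero_iff.mpr (Or.inl ?_))
  have := congrArg₂ (fun x y : ℝ => x + y) e1 e2
  rw [sub_sub, sub_eq_zero]
  rw [add_comm (∑ i, Real.negMulLog (flowerProb ι i))]
  exact this

theorem squashedEntanglement_flowerState_fstThd (U : unitaryGroup ι ℂ) :
    (flowerState U).fstThd.squashedEntanglement = 0 := by
  refine le_antisymm ?_ (QState.squashedEntanglement_nonneg _)
  have := QState.squashedEntanglement_le (flowerClassicalExtension ι)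
  rw [flowerClassicalExtension_fst U, flowerClassicalExtension_condMutualInfo] at this
  simpa using this

end FlowerSquashed

/-- Character values on a finite group have modulus one. This unbiasedness is all that the entropy
estimates use of the Fourier transform. -/
theorem IsFourierTransform.apply_mul_star {G : Type*} [AddCommGroup G] [Fintype G] [DecidableEq G]
    {U : unitaryGroup G ℂ} (h : IsFourierTransform U) (c x : G) :
    (U : Matrix G G ℂ) c x * star ((U : Matrix G G ℂ) c x) =
      ((Fintype.card G : ℝ)⁻¹ : ℝ) := by
  obtain ⟨χ, hχ⟩ := h
  rw [Complex.star_def, Complex.mul_conj, Complex.normSq_eq_norm_sq, hχ, norm_mul,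
    AddChar.norm_apply, norm_inv, Complex.norm_real, Real.norm_eq_abs, mul_one, inv_pow, sq_abs,
    Real.sq_sqrt (Nat.cast_nonneg _)]

/-- The matrix of the discrete Fourier transform of dimension `d`. -/
def dftMatrix (d : ℕ) [NeZero d] : Matrix (ZMod d) (ZMod d) ℂ :=
  of fun y x => ((Real.sqrt (Fintype.card (ZMod d)) : ℝ) : ℂ)⁻¹ * AddChar.zmodAddEquiv x y

/-! ### Unitarity of the discrete Fourier transform, and the failure of Non Lock. -/

theorem dftMatrix_mem_unitaryGroup (d : ℕ) [NeZero d] :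
    dftMatrix d ∈ unitaryGroup (ZMod d) ℂ := by
  rw [mem_unitaryGroup_iff']
  ext x x'
  have hd : (Fintype.card (ZMod d) : ℂ) ≠ 0 := by exact_mod_cast Fintype.card_ne_zero
  have hs : ((Real.sqrt (Fintype.card (ZMod d)) : ℝ) : ℂ)⁻¹ *
      ((Real.sqrt (Fintype.card (ZMod d)) : ℝ) : ℂ)⁻¹ = (Fintype.card (ZMod d) : ℂ)⁻¹ := by
    rw [← mul_inv, ← Complex.ofReal_mul, Real.mul_self_sqrt (Nat.cast_nonneg _)]
    push_cast; rfl
  have h : ∀ y, star (dftMatrix d y x) * dftMatrix d y x' = (Fintype.card (ZMod d) : ℂ)⁻¹ *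
      (AddChar.zmodAddEquiv (x' - x) : AddChar (ZMod d) ℂ) y := by
    intro y
    rw [map_sub, AddChar.sub_apply, AddChar.map_neg_eq_conj]
    simp only [dftMatrix, of_apply, star_mul', Complex.star_def, map_inv₀, Complex.conj_ofReal,
      ← hs]
    ring
  simp only [star_eq_conjTranspose, mul_apply, conjTranspose_apply, h]
  -- Orthogonality of characters: a nontrivial character sums to zero.
  rw [← mul_sum, AddChar.sum_eq_ite, one_apply]
  by_cases hx : x = x'
  · rw [hx, sub_self, map_zero, if_pos rfl, if_pos rfl, inv_mul_cancel₀ hd]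
  · have : (AddChar.zmodAddEquiv (x' - x) : AddChar (ZMod d) ℂ) ≠ 0 := by
      rw [ne_eq, EmbeddingLike.map_eq_zero_iff, sub_eq_zero]
      exact fun h => hx h.symm
    rw [if_neg this, if_neg hx, mul_zero]

/-- The discrete Fourier transform of dimension `d`. -/
def dft (d : ℕ) [NeZero d] : unitaryGroup (ZMod d) ℂ :=
  ⟨dftMatrix d, dftMatrix_mem_unitaryGroup d⟩

theorem isFourierTransform_dft (d : ℕ) [NeZero d] : IsFourierTransform (dft d) :=
  ⟨AddChar.zmodAddEquiv.toEquiv, fun _ _ => rfl⟩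

theorem squashedEntanglement_flowerState_dft (k : ℕ) :
    (flowerState (dft (2 ^ k))).squashedEntanglement = ((1 + 1 / 2 * k : ℝ) : EReal) := by
  rw [squashedEntanglement_flowerState (isFourierTransform_dft _).apply_mul_star, ZMod.card,
    Nat.cast_pow, Nat.cast_ofNat, Real.logb_pow, Real.logb_self_eq_one one_lt_two, mul_one]

/-- Discarding one qubit permits a drop of at most `c` under Non Lock, while for `d = 2 ^ k` the
drop is `1 + k / 2`. -/
theorem not_nonLock_squashedEntanglement :
    ¬ QState.NonLock (fun _ _ => QState.squashedEntanglement) := by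
  rintro ⟨c, hc, h⟩
  obtain ⟨k, hk⟩ := exists_nat_gt (2 * c)
  have h1 := h (ZMod (2 ^ k)) (Fin 2) (ZMod (2 ^ k) × Fin 2) (flowerState (dft (2 ^ k)))
  beta_reduce at h1
  rw [squashedEntanglement_flowerState_dft, squashedEntanglement_flowerState_fstThd, zero_add,
    EReal.coe_le_coe_iff] at h1
  set M := (flowerState (dft (2 ^ k))).fst.snd.mat
  have h2 : Real.logb 2 M.rank ≤ 1 := by
    have h3 : M.rank ≤ 2 := by simpa using M.rank_le_card_width
    -- Rank zero need not be excluded, since `Real.logb 2 0 = 0`.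
    rcases Nat.eq_zero_or_pos M.rank with h0 | h0
    · simp [h0]
    · rw [Real.logb_le_iff_le_rpow one_lt_two (by exact_mod_cast h0), Real.rpow_one]
      exact_mod_cast h3
  have h4 := mul_le_mul_of_nonneg_left h2 hc
  linarith

end

theorem mainTheorem12 :
    (∀ (G : Type*) [AddCommGroup G] [Fintype G] [DecidableEq G] (U : Matrix.unitaryGroup G ℂ),
      IsFourierTransform U →
        (flowerState U).squashedEntanglement =
          ((1 + 1 / 2 * Real.logb 2 (Fintype.card G) : ℝ) : EReal) ∧
        (flowerState U).fstThd.squashedEntanglement = 0) ∧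
    (∀ K : ℝ, ∃ (d : ℕ) (_ : NeZero d) (U : Matrix.unitaryGroup (ZMod d) ℂ),
      IsFourierTransform U ∧
        (flowerState U).fstThd.squashedEntanglement + (K : EReal) ≤
          (flowerState U).squashedEntanglement) ∧
    ¬ QState.NonLock (fun _ _ => QState.squashedEntanglement) := by
  refine ⟨fun G _ _ _ U hU => ⟨squashedEntanglement_flowerState hU.apply_mul_star,
    squashedEntanglement_flowerState_fstThd U⟩, fun K => ?_, not_nonLock_squashedEntanglement⟩
  obtain ⟨k, hk⟩ := exists_nat_gt (2 * K)
  refine ⟨2 ^ k, inferInstance, dft (2 ^ k), isFourierTransform_dft _, ?_⟩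
  rw [squashedEntanglement_flowerState_dft, squashedEntanglement_flowerState_fstThd, zero_add,
    EReal.coe_le_coe_iff]
  linarith
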